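/- For $x\in\mathbb{R}$ let $\|x\|$ denote the distance from $x$ to the nearest integer. For $\alpha>0$ and $M>0$ let $$B^\alpha_{[0,M]}=\{(\|x\|,\|\alpha x\|):x\in[0,M]\}\subset[0,\tfrac12]^2$$ be the truncated billiard orbit of initial slope $\alpha$ in the square $[0,\frac12]^2$, starting in the corner $(0,0)$. The pieces of the partition of $[0,\frac12]^2$ induced by $B^\alpha_{[0,M]}$ are the closures of the connected components of $[0,\frac12]^2\setminus B^\alpha_{[0,M]}$, and $\mathcal{A}^\alpha_{[0,M]}$ denotes the number of different areas of these pieces. **Proposition.** (1) For every rational $\alpha>0$ and every $M>0$ for which the orbit stops at a boundary point, i.e. $(\|M\|,\|\alpha M\|)\in[0,\frac12]^2\setminus(0,\frac12)^2$, one has $\mathcal{A}^\alpha_{[0,M]}\le 13$. This bound is the best possible: there are a rational $\alpha>0$ and such an $M$ with $\mathcal{A}^\alpha_{[0,M]}=13$. (2) For every rational $\alpha=p/q$, with $p,q$ coprime positive integers, there is an $M_0$ such that for all $M\ge M_0$ the partition induced by $B^\alpha_{[0,M]}$ is the same as the one induced by $B^\alpha_{[0,M_0]}$, one has $1\le\mathcal{A}^\alpha_{[0,M]}\le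 3$, and each piece of the partition is a rhombus of area $\frac{1}{2pq}$, a triangle of area $\frac{1}{4pq}$ or a triangle of area $\frac{1}{8pq}$. (3) Both bounds in (2) are sharp: there are a rational $\alpha>0$ and an $M_0$ with $\mathcal{A}^\alpha_{[0,M]}=1$ for all $M\ge M_0$, and a rational $\alpha>0$ and an $M_0$ with $\mathcal{A}^\alpha_{[0,M]}=3$ for all $M\ge M_0$. -/

import Mathlib

namespace Billiard

noncomputable section

/-- The distance `||x||` from `x` to the nearest integer. -/
def distInt (x : ℝ) : ℝ := |x - round x|

/-- The billiard table `[0, 1/2]²`. -/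
def table : Set (ℝ × ℝ) := Set.Icc 0 (1 / 2) ×ˢ Set.Icc 0 (1 / 2)

/-- The truncated billiard orbit `{(||x||, ||α x||) : x ∈ [0, M]}` of initial slope `α`,
shot from the corner `(0, 0)` of the table. -/
def orbit (α M : ℝ) : Set (ℝ × ℝ) :=
  (fun x : ℝ => (distInt x, distInt (α * x))) '' Set.Icc 0 M

/-- The orbit truncated at parameter `M` stops at a point of the boundary of the table. -/
def StopsOnBoundary (α M : ℝ) : Prop :=
  (distInt M, distInt (α * M)) ∈
    table \ (Set.Ioo (0 : ℝ) (1 / 2) ×ˢ Set.Ioo (0 : ℝ) (1 / 2))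

/-- The (closed) pieces of the partition of the table induced by the truncated orbit: the closures
of the connected components of the complement of the orbit in the table. -/
def pieces (α M : ℝ) : Set (Set (ℝ × ℝ)) :=
  {P | ∃ z ∈ table \ orbit α M, P = closure (connectedComponentIn (table \ orbit α M) z)}

/-- The number of different areas (two-dimensional Lebesgue measures) of the pieces. -/
def numAreas (α M : ℝ) : ℕ∞ :=
  ((fun P : Set (ℝ × ℝ) => MeasureTheory.volume P) '' pieces α M).encard

/-- The Euclidean distance in the plane (the distance that Mathlib puts on `ℝ × ℝ` is the
maximum distance). -/
def euclDist (a b : ℝ × ℝ) : ℝ := Real.sqrt ((a.1 - b.1) ^ 2 + (a.2 - b.2) ^ 2)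

/-- `P` is a (solid, nondegenerate) triangle. -/
def IsTriangle (P : Set (ℝ × ℝ)) : Prop :=
  ∃ a b c : ℝ × ℝ, AffineIndependent ℝ ![a, b, c] ∧ P = convexHull ℝ {a, b, c}

/-- `P` is a (solid, nondegenerate) rhombus `abcd`: a parallelogram with two adjacent sides
of equal length. -/
def IsRhombus (P : Set (ℝ × ℝ)) : Prop :=
  ∃ a b c d : ℝ × ℝ, AffineIndependent ℝ ![a, b, d] ∧ a + c = b + d ∧
    euclDist a b = euclDist a d ∧ P = convexHull ℝ {a, b, c, d}

end

end Billiard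

open Set MeasureTheory

namespace Billiard

noncomputable section

/-! Unfold the billiard and take the two directions of the orbit as coordinates. For α = p/q and M =
mq/(2p) the table becomes the tilted rectangle `region`, and the orbit becomes the part in it of the
lines z.1 = g and z.2 = g with g in `grid p q m`. Modulo 2p this grid is the progression -q(m-1),
-q(m-3), …, q(m-1) of step 2q. For even m the table is reflected first, so that the orbit always
ends on the top side. The pieces are then the rectangles gap × gap cut by `region`, with areas
scaled by 8pq (`toDiag_mem_iff`, `mem_pieces_iff`, `numAreas_eq_encard`).

The grid has at most three gap lengths (`three_gaps`), so uncut cells have at most six areas. The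
grid is 2p-periodic and symmetric, hence compatible with reflection in the left, right and bottom
sides: a cell cut by one of them is half a square, which gives three areas. Reflection in the top
side involves a shift by 2q, which fails to preserve the grid only at the ends of the progression
and adds one area (`volume_lower_cases`, `exists_truncArea`). Of the four corners, the one where the
orbit starts lies on a grid line, so cells around corners add at most three. The total is 6 + 3 + 3
+ 1 = 13 (`encard_cellVolumes_le`), attained for α = 22/27, m = 7. An orbit that stops on a vertical
side is handled by exchanging the axes (`numAreas_swap`).

For coprime p, q the orbit is complete at M = q/2, that is m = p. The grid then consists of all
integers of one parity, and the pieces are diamonds around integer points of [0,p] × [0,q]: whole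
inside, halved on a side, quartered at a corner (`exists_center`, `diamond_shape`). -/

/-! ### Gaps, cells and connected components in diagonal coordinates -/

/-- `a < b` are consecutive elements of `G`. -/
def IsGap (G : Set ℤ) (a b : ℤ) : Prop :=
  a ∈ G ∧ b ∈ G ∧ a < b ∧ ∀ z ∈ G, a < z → z < b → False

/-- The levels of the orbit segments in diagonal coordinates. -/
def grid (p q m : ℤ) : Set ℤ :=
  {x | ∃ s i : ℤ, -(m - 1) ≤ s ∧ s ≤ m - 1 ∧ Even (s - (m - 1)) ∧ x = q * s + 2 * p * i}

/-- The table in diagonal coordinates. -/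
def region (p q : ℤ) : Set (ℝ × ℝ) :=
  {z | 0 ≤ z.1 - z.2 ∧ z.1 - z.2 ≤ 2 * p ∧ -(2 * q) ≤ z.1 + z.2 ∧ z.1 + z.2 ≤ 0}

/-- An open axis-parallel rectangle with integer corners. -/
def box (a b c d : ℤ) : Set (ℝ × ℝ) := {z | a < z.1 ∧ z.1 < b ∧ c < z.2 ∧ z.2 < d}

/-- The part of a rectangle that lies in the table. -/
def cell (p q a b c d : ℤ) : Set (ℝ × ℝ) := box a b c d ∩ region p q

lemma convex_region (p q : ℤ) : Convex ℝ (region p q) := by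
  rintro ⟨x, y⟩ ⟨h1, h2, h3, h4⟩ ⟨x', y'⟩ ⟨h1', h2', h3', h4'⟩ s t hs ht hst
  simp only [region, mem_ofPred_eq, Prod.smul_mk, Prod.mk_add_mk, smul_eq_mul] at *
  obtain rfl : t = 1 - s := by linarith
  refine ⟨?_, ?_, ?_, ?_⟩ <;> nlinarith

lemma convex_box (a b c d : ℤ) : Convex ℝ (box a b c d) := by
  have : box a b c d = Ioo (a : ℝ) b ×ˢ Ioo (c : ℝ) d := by
    ext z; simp [box, and_assoc]
  rw [this]
  exact (convex_Ioo _ _).prod (convex_Ioo _ _)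

lemma convex_cell (p q a b c d : ℤ) : Convex ℝ (cell p q a b c d) :=
  (convex_box a b c d).inter (convex_region p q)

/-- The complement of the levels of `G` in `R`. -/
def gridCompl (G : Set ℤ) (R : Set (ℝ × ℝ)) : Set (ℝ × ℝ) :=
  {z | z ∈ R ∧ (∀ g ∈ G, (g : ℝ) ≠ z.1) ∧ ∀ g ∈ G, (g : ℝ) ≠ z.2}

lemma IsGap.ne {G : Set ℤ} {a b : ℤ} (h : IsGap G a b) {x : ℝ} (h1 : a < x) (h2 : x < b) :
    ∀ g ∈ G, (g : ℝ) ≠ x := by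
  rintro g hg rfl
  exact h.2.2.2 g hg (by exact_mod_cast h1) (by exact_mod_cast h2)

lemma mem_gap_of_isPreconnected {G : Set ℤ} {a b : ℤ} (h : IsGap G a b) {S : Set ℝ}
    (hS : IsPreconnected S) (hG : ∀ x ∈ S, ∀ g ∈ G, (g : ℝ) ≠ x) {x y : ℝ} (hx : x ∈ S)
    (hy : y ∈ S) (h1 : a < x) (h2 : x < b) : a < y ∧ y < b := by
  constructor
  · by_contra! hc
    exact hG a (hS.Icc_subset hy hx ⟨hc, h1.le⟩) a h.1 rfl
  · by_contra! hc
    exact hG b (hS.Icc_subset hx hy ⟨h2.le, hc⟩) b h.2.1 rfl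

/-- The two projections of a connected set that avoids the levels cannot leave a gap; conversely the
cut box is convex, hence connected. -/
lemma connectedComponentIn_gridCompl {G : Set ℤ} {R : Set (ℝ × ℝ)} (hR : Convex ℝ R)
    {a b c d : ℤ} (h : IsGap G a b) (h' : IsGap G c d) {z : ℝ × ℝ} (hz : z ∈ box a b c d ∩ R) :
    connectedComponentIn (gridCompl G R) z = box a b c d ∩ R := by
  have hsub : box a b c d ∩ R ⊆ gridCompl G R := fun w hw =>
    ⟨hw.2, h.ne hw.1.1 hw.1.2.1, h'.ne hw.1.2.2.1 hw.1.2.2.2⟩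
  apply Subset.antisymm
  · have hp := isPreconnected_connectedComponentIn (x := z) (F := gridCompl G R)
    have hs := connectedComponentIn_subset (gridCompl G R) z
    have hzm := mem_connectedComponentIn (hsub hz)
    intro w hw
    have h1 := mem_gap_of_isPreconnected h (hp.image _ continuous_fst.continuousOn)
      (by rintro _ ⟨v, hv, rfl⟩; exact (hs hv).2.1) (mem_image_of_mem _ hzm)
      (mem_image_of_mem _ hw) hz.1.1 hz.1.2.1
    have h2 := mem_gap_of_isPreconnected h' (hp.image _ continuous_snd.continuousOn)
      (by rintro _ ⟨v, hv, rfl⟩; exact (hs hv).2.2) (mem_image_of_mem _ hzm)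
      (mem_image_of_mem _ hw) hz.1.2.2.1 hz.1.2.2.2
    exact ⟨⟨h1.1, h1.2, h2.1, h2.2⟩, (hs hw).1⟩
  · exact ((convex_box a b c d).inter hR).isPreconnected.subset_connectedComponentIn hz hsub

lemma grid_add {p q m x : ℤ} (h : x ∈ grid p q m) (k : ℤ) : x + 2 * p * k ∈ grid p q m := by
  obtain ⟨s, i, h1, h2, h3, rfl⟩ := h
  exact ⟨s, i + k, h1, h2, h3, by ring⟩

lemma grid_neg {p q m x : ℤ} (h : x ∈ grid p q m) : -x ∈ grid p q m := by
  obtain ⟨s, i, h1, h2, h3, rfl⟩ := h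
  refine ⟨-s, -i, by omega, by omega, ?_, by ring⟩
  rw [Int.even_iff] at *; omega

/-- By 2p-periodicity there are levels on both sides of `x`, so a greatest one below and a least one
above. -/
lemma exists_isGap {p q m : ℤ} (hp : 0 < p) (hm : 0 < m) {x : ℝ}
    (hx : ∀ g ∈ grid p q m, (g : ℝ) ≠ x) : ∃ a b, IsGap (grid p q m) a b ∧ a < x ∧ x < b := by
  have h0 : q * (m - 1) ∈ grid p q m := ⟨m - 1, 0, by omega, le_rfl, by simp, by ring⟩
  have hp' : (1 : ℝ) ≤ p := by exact_mod_cast hp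
  obtain ⟨a, ⟨ha, hax⟩, ha'⟩ := Int.exists_greatest_of_bdd
    (P := fun z => z ∈ grid p q m ∧ (z : ℝ) < x)
    ⟨⌈x⌉, fun z hz => by exact_mod_cast (hz.2.trans_le (Int.le_ceil x)).le⟩ (by
      obtain ⟨n, hn⟩ := exists_nat_gt |(q * (m - 1) : ℝ) - x|
      refine ⟨_, grid_add h0 (-n), ?_⟩
      have := le_abs_self ((q * (m - 1) : ℝ) - x)
      push_cast
      have : (n : ℝ) ≤ p * n := le_mul_of_one_le_left (by positivity) hp'
      have : (0 : ℝ) ≤ n := by positivity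
      linarith)
  obtain ⟨b, ⟨hb, hbx⟩, hb'⟩ := Int.exists_least_of_bdd
    (P := fun z => z ∈ grid p q m ∧ x < (z : ℝ))
    ⟨⌊x⌋, fun z hz => by exact_mod_cast ((Int.floor_le x).trans_lt hz.2).le⟩ (by
      obtain ⟨n, hn⟩ := exists_nat_gt |(q * (m - 1) : ℝ) - x|
      refine ⟨_, grid_add h0 n, ?_⟩
      have := neg_abs_le ((q * (m - 1) : ℝ) - x)
      push_cast
      have : (n : ℝ) ≤ p * n := le_mul_of_one_le_left (by positivity) hp'
      have : (0 : ℝ) ≤ n := by positivity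
      linarith)
  refine ⟨a, b, ⟨ha, hb, by exact_mod_cast hax.trans hbx, fun z hz h1 h2 => ?_⟩, hax, hbx⟩
  rcases lt_or_gt_of_ne (hx z hz) with h | h
  · exact absurd (ha' z ⟨hz, h⟩) (by omega)
  · exact absurd (hb' z ⟨hz, h⟩) (by omega)

/-! ### Areas and components under plane maps -/

lemma volume_image_affine (a b c d e f : ℝ) (S : Set (ℝ × ℝ)) :
    volume ((fun z : ℝ × ℝ => (a * z.1 + b * z.2 + e, c * z.1 + d * z.2 + f)) '' S) =
      ENNReal.ofReal |a * d - b * c| * volume S := by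
  have h : (fun z : ℝ × ℝ => (a * z.1 + b * z.2 + e, c * z.1 + d * z.2 + f)) =
      (fun z => z + (e, f)) ∘
        (Matrix.toLin (.finTwoProd ℝ) (.finTwoProd ℝ) !![a, b; c, d]) := by
    ext z <;> simp [Matrix.toLin_finTwoProd_apply]
  rw [h, image_comp, image_add_right, measure_preimage_add_right,
    Measure.addHaar_image_linearMap, LinearMap.det_toLin, Matrix.det_fin_two_of]

lemma volume_preimage_affine {a b c d : ℝ} (e f : ℝ) (h : a * d - b * c ≠ 0)
    (S : Set (ℝ × ℝ)) :
    ENNReal.ofReal |a * d - b * c| *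
      volume ((fun z : ℝ × ℝ => (a * z.1 + b * z.2 + e, c * z.1 + d * z.2 + f)) ⁻¹' S) =
      volume S := by
  rw [← volume_image_affine, image_preimage_eq]
  rintro ⟨x, y⟩
  refine ⟨((d * (x - e) - b * (y - f)) / (a * d - b * c),
    (a * (y - f) - c * (x - e)) / (a * d - b * c)), ?_⟩
  generalize hD : a * d - b * c = D at h ⊢
  ext <;> simp only <;> field_simp <;> rw [← hD] <;> ring

/-- The closures of the connected components of `D`. -/
def closedComponents (D : Set (ℝ × ℝ)) : Set (Set (ℝ × ℝ)) :=
  {P | ∃ z ∈ D, P = closure (connectedComponentIn D z)}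

lemma closedComponents_image (h : ℝ × ℝ ≃ₜ ℝ × ℝ) (D : Set (ℝ × ℝ)) :
    closedComponents (h '' D) = (fun P => h '' P) '' closedComponents D := by
  ext P
  constructor
  · rintro ⟨_, ⟨z, hz, rfl⟩, rfl⟩
    exact ⟨_, ⟨z, hz, rfl⟩, by
      rw [← h.image_connectedComponentIn hz]; exact h.image_closure _⟩
  · rintro ⟨_, ⟨z, hz, rfl⟩, rfl⟩
    refine ⟨h z, mem_image_of_mem _ hz, ?_⟩
    rw [← h.image_connectedComponentIn hz]
    exact h.image_closure _

lemma mem_closedComponents_gridCompl {p q m : ℤ} (hp : 0 < p) (hm : 0 < m) {P : Set (ℝ × ℝ)} :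
    P ∈ closedComponents (gridCompl (grid p q m) (region p q)) ↔
      ∃ a b c d, IsGap (grid p q m) a b ∧ IsGap (grid p q m) c d ∧
        (cell p q a b c d).Nonempty ∧ P = closure (cell p q a b c d) := by
  constructor
  · rintro ⟨z, hz, rfl⟩
    obtain ⟨a, b, h, h1, h2⟩ := exists_isGap hp hm hz.2.1
    obtain ⟨c, d, h', h3, h4⟩ := exists_isGap hp hm hz.2.2
    have hzc : z ∈ cell p q a b c d := ⟨⟨h1, h2, h3, h4⟩, hz.1⟩
    exact ⟨a, b, c, d, h, h', ⟨z, hzc⟩, by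
      rw [connectedComponentIn_gridCompl (convex_region p q) h h' hzc]; rfl⟩
  · rintro ⟨a, b, c, d, h, h', ⟨z, hz⟩, rfl⟩
    exact ⟨z, ⟨hz.2, h.ne hz.1.1 hz.1.2.1, h'.ne hz.1.2.2.1 hz.1.2.2.2⟩, by
      rw [connectedComponentIn_gridCompl (convex_region p q) h h' hz]; rfl⟩

lemma volume_closure_of_convex {S : Set (ℝ × ℝ)} (h : Convex ℝ S) :
    volume (closure S) = volume S :=
  measure_congr (closure_ae_eq_of_null_frontier (h.addHaar_frontier volume))

/-! ### Unfolding the orbit -/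

lemma distInt_eq_iff {x u : ℝ} (h0 : 0 ≤ u) (h1 : u ≤ 1 / 2) :
    distInt x = u ↔ ∃ n : ℤ, x = n + u ∨ x = n - u := by
  constructor
  · intro h
    refine ⟨round x, ?_⟩
    unfold distInt at h
    rcases abs_cases (x - round x) with ⟨h2, -⟩ | ⟨h2, -⟩
    · left; linarith
    · right; linarith
  · unfold distInt
    rintro ⟨n, rfl | rfl⟩
    · rw [abs_sub_round_eq_min, Int.fract_intCast_add, Int.fract_eq_self.2 ⟨h0, by linarith⟩]
      exact min_eq_left (by linarith)
    · rcases h0.eq_or_lt with rfl | h0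
      · simp
      · have : Int.fract ((n : ℝ) - u) = 1 - u :=
          Int.fract_eq_iff.2 ⟨by linarith, by linarith, n - 1, by push_cast; ring⟩
        rw [abs_sub_round_eq_min, this]
        exact (min_eq_right (by linarith)).trans (by ring)

lemma mem_table {z : ℝ × ℝ} :
    z ∈ table ↔ (0 ≤ z.1 ∧ z.1 ≤ 1 / 2) ∧ 0 ≤ z.2 ∧ z.2 ≤ 1 / 2 := Iff.rfl

/-- Replacing `x` by `-x` trades the branch x = n - z.1 for negative times, so only the second
coordinate keeps a choice of sign. -/
lemma mem_orbit_iff {α M : ℝ} {z : ℝ × ℝ} (hz : z ∈ table) :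
    z ∈ orbit α M ↔ ∃ x, -M ≤ x ∧ x ≤ M ∧ (∃ n : ℤ, x = n + z.1) ∧
      ∃ k : ℤ, α * x = k + z.2 ∨ α * x = k - z.2 := by
  obtain ⟨u, v⟩ := z
  obtain ⟨⟨h1, h2⟩, h3, h4⟩ := mem_table.1 hz
  dsimp only at *
  constructor
  · rintro ⟨x, ⟨hx, hx'⟩, h⟩
    rw [Prod.mk.injEq, distInt_eq_iff h1 h2, distInt_eq_iff h3 h4] at h
    obtain ⟨⟨n, hn⟩, k, hk⟩ := h
    rcases hn with hn | hn
    · exact ⟨x, by linarith, hx', ⟨n, hn⟩, k, hk⟩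
    · refine ⟨-x, by linarith, by linarith, ⟨-n, by push_cast; linarith⟩, -k, ?_⟩
      push_cast
      rcases hk with hk | hk
      · right; linarith
      · left; linarith
  · rintro ⟨x, hx, hx', ⟨n, hn⟩, k, hk⟩
    rcases le_total 0 x with h | h
    · refine ⟨x, ⟨h, hx'⟩, ?_⟩
      rw [Prod.mk.injEq, distInt_eq_iff h1 h2, distInt_eq_iff h3 h4]
      exact ⟨⟨n, Or.inl hn⟩, k, hk⟩
    · refine ⟨-x, ⟨by linarith, by linarith⟩, ?_⟩
      rw [Prod.mk.injEq, distInt_eq_iff h1 h2, distInt_eq_iff h3 h4]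
      refine ⟨⟨-n, Or.inr (by push_cast; linarith)⟩, -k, ?_⟩
      push_cast
      rcases hk with hk | hk
      · right; linarith
      · left; linarith

/-! ### The orbit as a grid of lines -/

/-- The passage to diagonal coordinates. -/
def diag (α β τ : ℝ) (hα : α ≠ 0) (hβ : β ≠ 0) : ℝ × ℝ ≃ₜ ℝ × ℝ where
  toFun z := (α * z.1 + -β * z.2 + -τ, -α * z.1 + -β * z.2 + -τ)
  invFun w := ((w.1 - w.2) / (2 * α), -(w.1 + w.2 + 2 * τ) / (2 * β))
  left_inv z := by ext <;> simp only <;> field_simp <;> ring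
  right_inv w := by ext <;> simp only <;> field_simp <;> ring
  continuous_toFun := by fun_prop
  continuous_invFun := by fun_prop

lemma volume_diag_image {α β τ : ℝ} (hα : α ≠ 0) (hβ : β ≠ 0) (S : Set (ℝ × ℝ)) :
    volume (diag α β τ hα hβ '' S) = ENNReal.ofReal |2 * α * β| * volume S := by
  have := volume_image_affine α (-β) (-α) (-β) (-τ) (-τ) S
  rw [show α * -β - -β * -α = -(2 * α * β) by ring, abs_neg] at this
  exact this

/-- Eliminating `t` turns the two signs of `b` into the levels a - b and -a - b. Since 0 ≤ b ≤ q,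
the time bound |t| ≤ mq together with the parity of `r` amounts to |s| ≤ m - 1, except on the side b
= q. -/
lemma orbit_iff_grid {p q m : ℤ} (hq : 0 < q) (hm : 0 < m) {a b : ℝ}
    (hb0 : 0 ≤ b) (hbq : b ≤ q) :
    (∃ t : ℝ, -(m * q) ≤ t ∧ t ≤ m * q ∧ (∃ n : ℤ, t = a + 2 * p * n) ∧
      ∃ r : ℤ, Even (r - (m - 1)) ∧ (t = b + q * r ∨ t = -b + q * r)) ↔
    (∃ g ∈ grid p q m, (g : ℝ) = a - b) ∨ ∃ g ∈ grid p q m, (g : ℝ) = -a - b := by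
  have hq' : (0 : ℝ) < q := by exact_mod_cast hq
  constructor
  · rintro ⟨t, ht, ht', ⟨n, hn⟩, r, hr, h⟩
    rw [Int.even_iff] at hr
    rcases h with h | h
    · have h1 : r < m + 1 := by
        by_contra! hc
        have : (m : ℝ) + 1 ≤ r := by exact_mod_cast hc
        nlinarith
      have h2 : -m - 2 < r := by
        by_contra! hc
        have : (r : ℝ) ≤ -m - 2 := by exact_mod_cast hc
        nlinarith
      by_cases h3 : r = -m - 1
      · right
        subst h3
        push_cast at h
        have hb : b = q := by nlinarith
        refine ⟨_, ⟨m - 1, n, by omega, le_rfl, by simp, rfl⟩, ?_⟩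
        push_cast
        linarith
      · left
        refine ⟨_, ⟨r, -n, by omega, by omega, by rw [Int.even_iff]; omega, rfl⟩, ?_⟩
        push_cast
        linarith
    · have h1 : -m - 1 < r := by
        by_contra! hc
        have : (r : ℝ) ≤ -m - 1 := by exact_mod_cast hc
        nlinarith
      have h2 : r < m + 2 := by
        by_contra! hc
        have : (m : ℝ) + 2 ≤ r := by exact_mod_cast hc
        nlinarith
      by_cases h3 : r = m + 1
      · left
        subst h3
        push_cast at h
        have hb : b = q := by nlinarith
        refine ⟨_, ⟨m - 1, -n, by omega, le_rfl, by simp, rfl⟩, ?_⟩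
        push_cast
        linarith
      · right
        refine ⟨_, ⟨-r, n, by omega, by omega, by rw [Int.even_iff]; omega, rfl⟩, ?_⟩
        push_cast
        linarith
  · rintro (⟨_, ⟨s, i, h1, h2, h3, rfl⟩, h⟩ | ⟨_, ⟨s, i, h1, h2, h3, rfl⟩, h⟩) <;>
      push_cast at h <;>
      [refine ⟨a - 2 * p * i, ?_, ?_, ⟨-i, by push_cast; ring⟩, s, h3, Or.inl (by linarith)⟩;
       refine ⟨a + 2 * p * i, ?_, ?_, ⟨i, by ring⟩, -s,
        by rw [Int.even_iff] at *; omega, Or.inr (by push_cast; linarith)⟩] <;>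
      have h1' : -((m : ℝ) - 1) ≤ s := (by exact_mod_cast h1) <;>
      have h2' : (s : ℝ) ≤ m - 1 := (by exact_mod_cast h2) <;>
      nlinarith

/-- The second coefficients of the passage to diagonal coordinates, which reflects the table
when `m` is even. -/
def diagCoeff (q m : ℤ) : ℝ × ℝ := if Even m then (-(2 * q), q) else (2 * q, 0)

lemma diagCoeff_ne {q m : ℤ} (hq : 0 < q) : (diagCoeff q m).1 ≠ 0 := by
  have hq' : (0 : ℝ) < q := by exact_mod_cast hq
  unfold diagCoeff
  split_ifs <;> simp <;> positivity

lemma two_mul_cast_ne {p : ℤ} (hp : 0 < p) : (2 * p : ℝ) ≠ 0 := by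
  have hp' : (0 : ℝ) < p := by exact_mod_cast hp
  positivity

/-- The passage to diagonal coordinates for the orbit that makes `m` vertical crossings. -/
def toDiag {p q : ℤ} (m : ℤ) (hp : 0 < p) (hq : 0 < q) : ℝ × ℝ ≃ₜ ℝ × ℝ :=
  diag (2 * p) (diagCoeff q m).1 (diagCoeff q m).2 (two_mul_cast_ne hp) (diagCoeff_ne hq)

lemma volume_toDiag_image {p q m : ℤ} (hp : 0 < p) (hq : 0 < q) (S : Set (ℝ × ℝ)) :
    volume (toDiag m hp hq '' S) = ENNReal.ofReal (8 * p * q) * volume S := by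
  have hp' : (0 : ℝ) < p := by exact_mod_cast hp
  have hq' : (0 : ℝ) < q := by exact_mod_cast hq
  have : |2 * (2 * p : ℝ) * (diagCoeff q m).1| = 8 * p * q := by
    unfold diagCoeff
    split_ifs
    · rw [show 2 * (2 * p : ℝ) * -(2 * q) = -(8 * p * q) by ring, abs_neg]
      exact abs_of_pos (by positivity)
    · simp only
      rw [show 2 * (2 * p : ℝ) * (2 * q) = (8 * p * q) by ring]
      exact abs_of_pos (by positivity)
  rw [← this]
  exact volume_diag_image _ _ _

/-- With t = 2px the condition on αx reads t = ±b + qr. Here b is 2qv for odd m and q - 2qv for even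
m; this reflection makes the parity condition r ≡ m - 1 (mod 2) uniform in m. -/
lemma toDiag_mem_iff {p q m : ℤ} (hp : 0 < p) (hq : 0 < q) (hm : 0 < m) (z : ℝ × ℝ) :
    toDiag m hp hq z ∈ gridCompl (grid p q m) (region p q) ↔
      z ∈ table \ orbit (p / q) (m * q / (2 * p)) := by
  have hp' : (0 : ℝ) < p := by exact_mod_cast hp
  have hq' : (0 : ℝ) < q := by exact_mod_cast hq
  obtain ⟨u, v⟩ := z
  set b : ℝ := (diagCoeff q m).1 * v + (diagCoeff q m).2 with hb
  have hφ : toDiag m hp hq (u, v) = (2 * p * u - b, -(2 * p * u) - b) := by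
    change (_, _) = _
    ext <;> simp only [hb] <;> ring
  have hbv : 0 ≤ v ∧ v ≤ 1 / 2 ↔ 0 ≤ b ∧ b ≤ q := by
    rw [hb]
    unfold diagCoeff
    split_ifs <;> constructor <;> rintro ⟨h1, h2⟩ <;> constructor <;> simp only at * <;> nlinarith
  have hu : 0 ≤ u ∧ u ≤ 1 / 2 ↔ 0 ≤ 2 * p * u ∧ 2 * p * u ≤ p := by
    constructor <;> rintro ⟨h1, h2⟩ <;> constructor <;> nlinarith
  have htab : (u, v) ∈ table ↔ (2 * p * u - b, -(2 * p * u) - b) ∈ region p q := by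
    rw [mem_table, hu, hbv]
    simp only [region, mem_ofPred_eq]
    constructor
    · rintro ⟨⟨h1, h2⟩, h3, h4⟩
      refine ⟨?_, ?_, ?_, ?_⟩ <;> linarith
    · rintro ⟨h1, h2, h3, h4⟩
      refine ⟨⟨?_, ?_⟩, ?_, ?_⟩ <;> linarith
  rw [hφ]
  by_cases ht : (u, v) ∈ table
  swap
  · exact iff_of_false (fun h => ht (htab.2 h.1)) (fun h => ht h.1)
  have hbb := hbv.1 (mem_table.1 ht).2
  have key : (u, v) ∈ orbit (p / q) (m * q / (2 * p)) ↔
      ∃ t : ℝ, -(m * q) ≤ t ∧ t ≤ m * q ∧ (∃ n : ℤ, t = 2 * p * u + 2 * p * n) ∧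
        ∃ r : ℤ, Even (r - (m - 1)) ∧ (t = b + q * r ∨ t = -b + q * r) := by
    rw [mem_orbit_iff ht]
    have hiff : ∀ x : ℝ, (∃ k : ℤ, (p : ℝ) / q * x = k + v ∨ (p : ℝ) / q * x = k - v) ↔
        ∃ r : ℤ, Even (r - (m - 1)) ∧ (2 * p * x = b + q * r ∨ 2 * p * x = -b + q * r) := by
      intro x
      have h1 : ∀ y : ℝ, (p : ℝ) / q * x = y ↔ 2 * p * x = 2 * q * y := by
        intro y
        constructor
        · rintro rfl; field_simp
        · intro h; field_simp; linarith
      simp only [h1, hb]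
      unfold diagCoeff
      split_ifs with hm2
      · rw [Int.even_iff] at hm2
        constructor
        · rintro ⟨k, hk | hk⟩
          · exact ⟨2 * k + 1, by rw [Int.even_iff]; omega, Or.inr (by push_cast; linarith)⟩
          · exact ⟨2 * k - 1, by rw [Int.even_iff]; omega, Or.inl (by push_cast; linarith)⟩
        · rintro ⟨r, hr, h⟩
          obtain ⟨k, rfl⟩ : ∃ k, r = 2 * k + 1 :=
            ⟨(r - 1) / 2, by rw [Int.even_iff] at hr; omega⟩
          push_cast at h
          rcases h with h | h
          · exact ⟨k + 1, Or.inr (by push_cast; linarith)⟩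
          · exact ⟨k, Or.inl (by linarith)⟩
      · rw [Int.even_iff] at hm2
        constructor
        · rintro ⟨k, hk | hk⟩
          · exact ⟨2 * k, by rw [Int.even_iff]; omega, Or.inl (by push_cast; linarith)⟩
          · exact ⟨2 * k, by rw [Int.even_iff]; omega, Or.inr (by push_cast; linarith)⟩
        · rintro ⟨r, hr, h⟩
          obtain ⟨k, rfl⟩ : ∃ k, r = 2 * k :=
            ⟨r / 2, by rw [Int.even_iff] at hr; omega⟩
          push_cast at h
          rcases h with h | h
          · exact ⟨k, Or.inl (by linarith)⟩
          · exact ⟨k, Or.inr (by linarith)⟩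
    constructor
    · rintro ⟨x, hx, hx', ⟨n, rfl⟩, h⟩
      refine ⟨2 * p * (n + u), ?_, ?_, ⟨n, by ring⟩, (hiff _).1 h⟩
      · rw [← neg_div, div_le_iff₀ (by positivity)] at hx; linarith
      · rw [le_div_iff₀ (by positivity)] at hx'; linarith
    · rintro ⟨t, hx, hx', ⟨n, rfl⟩, h⟩
      refine ⟨n + u, ?_, ?_, ⟨n, rfl⟩, (hiff _).2 ?_⟩
      · rw [← neg_div, div_le_iff₀ (by positivity)]; linarith
      · rw [le_div_iff₀ (by positivity)]; linarith
      · rw [show 2 * (p : ℝ) * (n + u) = 2 * p * u + 2 * p * n by ring]; exact h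
  rw [mem_sdiff, key, orbit_iff_grid hq hm hbb.1 hbb.2]
  simp only [gridCompl, mem_ofPred_eq, ← htab, ht, true_and, not_or, not_exists, not_and]

/-! ### Areas of pieces as areas of cells -/

/-- The areas of the cells, in diagonal coordinates. -/
def cellVolumes (p q m : ℤ) : Set ENNReal :=
  {V | ∃ a b c d, IsGap (grid p q m) a b ∧ IsGap (grid p q m) c d ∧
    (cell p q a b c d).Nonempty ∧ V = volume (cell p q a b c d)}

lemma mem_pieces_iff {p q m : ℤ} (hp : 0 < p) (hq : 0 < q) (hm : 0 < m) {P : Set (ℝ × ℝ)} :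
    P ∈ pieces (p / q) (m * q / (2 * p)) ↔
      ∃ a b c d, IsGap (grid p q m) a b ∧ IsGap (grid p q m) c d ∧
        (cell p q a b c d).Nonempty ∧ toDiag m hp hq '' P = closure (cell p q a b c d) := by
  have h : toDiag m hp hq '' (table \ orbit (p / q) (m * q / (2 * p))) =
      gridCompl (grid p q m) (region p q) := by
    ext w
    obtain ⟨z, rfl⟩ := (toDiag m hp hq).surjective w
    rw [toDiag_mem_iff hp hq hm, (toDiag m hp hq).injective.mem_set_image]
  rw [← mem_closedComponents_gridCompl hp hm, ← h, closedComponents_image,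
    (image_injective.2 (toDiag m hp hq).injective).mem_set_image]
  rfl

lemma volume_piece {p q m : ℤ} (hp : 0 < p) (hq : 0 < q) {P : Set (ℝ × ℝ)}
    {a b c d : ℤ} (h : toDiag m hp hq '' P = closure (cell p q a b c d)) :
    ENNReal.ofReal (8 * p * q) * volume P = volume (cell p q a b c d) := by
  rw [← volume_toDiag_image (m := m) hp hq, h, volume_closure_of_convex (convex_cell ..)]

lemma numAreas_eq_encard {p q m : ℤ} (hp : 0 < p) (hq : 0 < q) (hm : 0 < m) :
    numAreas (p / q) (m * q / (2 * p)) = (cellVolumes p q m).encard := by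
  have hp' : (0 : ℝ) < p := by exact_mod_cast hp
  have hq' : (0 : ℝ) < q := by exact_mod_cast hq
  have hinj : Function.Injective (fun V : ENNReal => ENNReal.ofReal (8 * p * q) * V) :=
    fun V W h => (ENNReal.mul_right_inj (by
      rw [Ne, ENNReal.ofReal_eq_zero, not_le]; positivity) ENNReal.ofReal_ne_top).1 h
  rw [numAreas, ← hinj.encard_image, image_image]
  congr 1
  ext V
  constructor
  · rintro ⟨P, hP, rfl⟩
    obtain ⟨a, b, c, d, h, h', hn, hP⟩ := (mem_pieces_iff hp hq hm).1 hP
    exact ⟨a, b, c, d, h, h', hn, volume_piece hp hq hP⟩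
  · rintro ⟨a, b, c, d, h, h', hn, rfl⟩
    have hP : toDiag m hp hq '' (toDiag m hp hq ⁻¹' closure (cell p q a b c d)) =
        closure (cell p q a b c d) := image_preimage_eq _ (toDiag m hp hq).surjective
    exact ⟨_, (mem_pieces_iff hp hq hm).2 ⟨a, b, c, d, h, h', hn, hP⟩, volume_piece hp hq hP⟩

/-! ### Areas of cells, whole and cut by the sides -/

lemma volume_preimage_of_det {a b c d : ℝ} (e f : ℝ) (h : |a * d - b * c| = 1)
    (S : Set (ℝ × ℝ)) :
    volume ((fun z : ℝ × ℝ => (a * z.1 + b * z.2 + e, c * z.1 + d * z.2 + f)) ⁻¹' S) =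
      volume S := by
  have := volume_preimage_affine (a := a) (b := b) (c := c) (d := d) e f
    (fun h0 => by rw [h0] at h; simp at h) S
  rwa [h, ENNReal.ofReal_one, one_mul] at this

lemma volume_eq_of_slices {S : Set (ℝ × ℝ)} (hS : MeasurableSet S) {l r : ℝ} (hlr : l ≤ r)
    {f : ℝ → ℝ} (hf : Continuous f) (hf0 : ∀ x, l < x → x < r → 0 ≤ f x)
    (h : ∀ x, l < x → x < r → volume (Prod.mk x ⁻¹' S) = ENNReal.ofReal (f x))
    (h0 : ∀ z ∈ S, l < z.1 ∧ z.1 < r) :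
    volume S = ENNReal.ofReal (∫ x in l..r, f x) := by
  have hs : (fun x => volume (Prod.mk x ⁻¹' S)) =
      (Ioo l r).indicator (fun x => ENNReal.ofReal (f x)) := by
    ext x
    by_cases hx : x ∈ Ioo l r
    · rw [indicator_of_mem hx, h x hx.1 hx.2]
    · have : Prod.mk x ⁻¹' S = ∅ := eq_empty_of_forall_notMem fun y hy => hx (h0 (x, y) hy)
      rw [indicator_of_notMem hx, this, measure_empty]
  rw [Measure.volume_eq_prod, Measure.prod_apply hS, hs, lintegral_indicator measurableSet_Ioo,
    intervalIntegral.integral_of_le hlr, integral_Ioc_eq_integral_Ioo,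
    ofReal_integral_eq_lintegral_ofReal]
  · exact (hf.integrableOn_Icc).mono_set Ioo_subset_Icc_self
  · filter_upwards [ae_restrict_mem measurableSet_Ioo] with x hx using hf0 x hx.1 hx.2

lemma volume_triangle {l r : ℝ} (h : l ≤ r) :
    volume {z : ℝ × ℝ | l < z.2 ∧ z.2 ≤ z.1 ∧ z.1 < r} = ENNReal.ofReal ((r - l) ^ 2 / 2) := by
  rw [volume_eq_of_slices (f := fun x => x - l) (l := l) (r := r)]
  · congr 1
    rw [intervalIntegral.integral_sub (by simp) (by simp)]
    simp
    ring
  · exact (measurableSet_lt measurable_const measurable_snd).inter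
      ((measurableSet_le measurable_snd measurable_fst).inter
        (measurableSet_lt measurable_fst measurable_const))
  · exact h
  · fun_prop
  · intro x h1 _; linarith
  · intro x h1 h2
    rw [show Prod.mk x ⁻¹' {z : ℝ × ℝ | l < z.2 ∧ z.2 ≤ z.1 ∧ z.1 < r} = Ioc l x by
      ext y; simp [h2], Real.volume_Ioc]
  · rintro z ⟨h1, h2, h3⟩
    exact ⟨by linarith, h3⟩

/-- A right isosceles triangle with its right angle at the origin. -/
def quarter (h : ℝ) : Set (ℝ × ℝ) := {z | -h < z.1 ∧ z.2 ≤ -z.1 ∧ z.1 ≤ z.2}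

lemma volume_quarter {h : ℝ} (h0 : 0 ≤ h) : volume (quarter h) = ENNReal.ofReal (h ^ 2) := by
  have hS : MeasurableSet (quarter h ∩ {z | z.1 < 0}) := by
    exact ((measurableSet_lt measurable_const measurable_fst).inter
      ((measurableSet_le measurable_snd measurable_fst.neg).inter
        (measurableSet_le measurable_fst measurable_snd))).inter
        (measurableSet_lt measurable_fst measurable_const)
  -- The apex lies over the excluded endpoint of the slicing interval, so it is removed as a null
  -- set.
  have hnull : volume (quarter h \ (quarter h ∩ {z | z.1 < 0})) = 0 := by
    apply measure_mono_null (t := {((0 : ℝ), (0 : ℝ))})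
    · rintro ⟨x, y⟩ ⟨⟨h1, h2, h3⟩, h4⟩
      have h5 : 0 ≤ x := by
        by_contra! hx
        exact h4 ⟨⟨h1, h2, h3⟩, hx⟩
      simp only [mem_singleton_iff, Prod.mk.injEq] at *
      constructor <;> linarith
    · simp
  rw [← measure_inter_add_sdiff _ hS, hnull, add_zero, inter_eq_self_of_subset_right
      inter_subset_left, volume_eq_of_slices (f := fun x => -(2 * x)) (l := -h) (r := 0)]
  · congr 1
    rw [intervalIntegral.integral_neg, intervalIntegral.integral_const_mul]
    simp
    ring
  · exact hS
  · linarith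
  · fun_prop
  · intro x _ h2; linarith
  · intro x h1 h2
    have : Prod.mk x ⁻¹' (quarter h ∩ {z | z.1 < 0}) = Icc x (-x) := by
      ext y; simp [quarter, h1, h2, and_comm]
    rw [this, Real.volume_Icc]
    congr 1; ring
  · rintro z ⟨⟨h1, -, -⟩, h2⟩
    exact ⟨h1, h2⟩

lemma volume_rectangle {a b c d : ℝ} (h : a ≤ b) {S : Set (ℝ × ℝ)} {s t : Set ℝ}
    (hS : ∀ z : ℝ × ℝ, z ∈ S ↔ z.1 ∈ s ∧ z.2 ∈ t) (hs : volume s = ENNReal.ofReal (b - a))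
    (ht : volume t = ENNReal.ofReal (d - c)) :
    volume S = ENNReal.ofReal ((b - a) * (d - c)) := by
  rw [show S = s ×ˢ t from ext hS, Measure.volume_eq_prod, Measure.prod_prod, hs, ht,
    ENNReal.ofReal_mul (by linarith)]

lemma volume_box {a b c d : ℤ} (h : a ≤ b) :
    volume (box a b c d) = ENNReal.ofReal ((b - a) * (d - c)) :=
  volume_rectangle (by exact_mod_cast h) (s := Ioo a b) (t := Ioo c d)
    (fun z => by simp [box, and_assoc]) Real.volume_Ioo Real.volume_Ioo

/-- The part of a rectangle below the diagonal. -/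
def lower (a b c d : ℤ) : Set (ℝ × ℝ) := {z | z ∈ box a b c d ∧ z.2 ≤ z.1}

lemma volume_lower_of_le {a b c d : ℤ} (hac : a ≤ c) (hbd : b ≤ d) (hcb : c ≤ b) :
    volume (lower a b c d) = ENNReal.ofReal ((b - c) ^ 2 / 2) := by
  have hac : (a : ℝ) ≤ c := by exact_mod_cast hac
  have hbd : (b : ℝ) ≤ d := by exact_mod_cast hbd
  rw [← volume_triangle (by exact_mod_cast hcb)]
  congr 1
  ext z
  constructor
  · rintro ⟨⟨h1, h2, h3, h4⟩, h5⟩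
    exact ⟨h3, h5, h2⟩
  · rintro ⟨h1, h2, h3⟩
    exact ⟨⟨by linarith, h3, h1, by linarith⟩, h2⟩

/-- The vertical line z.1 = d splits the trapezoid into a half square and a rectangle. -/
lemma volume_lower_left {a b d : ℤ} (had : a ≤ d) (hdb : d ≤ b) :
    volume (lower a b a d) = ENNReal.ofReal ((d - a) ^ 2 / 2 + (b - d) * (d - a)) := by
  have had' : (a : ℝ) ≤ d := by exact_mod_cast had
  have hdb' : (d : ℝ) ≤ b := by exact_mod_cast hdb
  have h : lower a b a d = lower a d a d ∪ Ico (d : ℝ) b ×ˢ Ioo (a : ℝ) d := by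
    ext z
    simp only [lower, box, mem_union, mem_prod, mem_Ico, mem_Ioo, mem_ofPred_eq]
    constructor
    · rintro ⟨⟨h1, h2, h3, h4⟩, h5⟩
      rcases lt_or_ge z.1 d with h | h
      · exact Or.inl ⟨⟨h1, h, h3, h4⟩, h5⟩
      · exact Or.inr ⟨⟨h, h2⟩, h3, h4⟩
    · rintro (⟨⟨h1, h2, h3, h4⟩, h5⟩ | ⟨⟨h1, h2⟩, h3, h4⟩)
      · exact ⟨⟨h1, by linarith, h3, h4⟩, h5⟩
      · exact ⟨⟨by linarith, h2, h3, h4⟩, by linarith⟩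
  rw [h, measure_union _ (measurableSet_Ico.prod measurableSet_Ioo),
    volume_lower_of_le le_rfl le_rfl had,
    volume_rectangle hdb' (fun z => mem_prod) Real.volume_Ico Real.volume_Ioo,
    ← ENNReal.ofReal_add (by positivity) (by nlinarith)]
  rw [Set.disjoint_left]
  rintro z ⟨⟨-, h, -⟩, -⟩ ⟨⟨h', -⟩, -⟩
  linarith

lemma volume_lower_right {a b c : ℤ} (hca : c ≤ a) (hab : a ≤ b) :
    volume (lower a b c b) = ENNReal.ofReal ((b - a) ^ 2 / 2 + (b - a) * (a - c)) := by
  have hca' : (c : ℝ) ≤ a := by exact_mod_cast hca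
  have hab' : (a : ℝ) ≤ b := by exact_mod_cast hab
  have h : lower a b c b = lower a b a b ∪ Ioo (a : ℝ) b ×ˢ Ioc (c : ℝ) a := by
    ext z
    simp only [lower, box, mem_union, mem_prod, mem_Ioc, mem_Ioo, mem_ofPred_eq]
    constructor
    · rintro ⟨⟨h1, h2, h3, h4⟩, h5⟩
      rcases lt_or_ge (a : ℝ) z.2 with h | h
      · exact Or.inl ⟨⟨h1, h2, h, h4⟩, h5⟩
      · exact Or.inr ⟨⟨h1, h2⟩, h3, h⟩
    · rintro (⟨⟨h1, h2, h3, h4⟩, h5⟩ | ⟨⟨h1, h2⟩, h3, h4⟩)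
      · exact ⟨⟨h1, by linarith, by linarith, h4⟩, h5⟩
      · exact ⟨⟨h1, h2, h3, by linarith⟩, by linarith⟩
  rw [h, measure_union _ (measurableSet_Ioo.prod measurableSet_Ioc),
    volume_lower_of_le le_rfl le_rfl hab,
    volume_rectangle hab' (fun z => mem_prod) Real.volume_Ioo Real.volume_Ioc,
    ← ENNReal.ofReal_add (by positivity) (by nlinarith)]
  rw [Set.disjoint_left]
  rintro z ⟨⟨-, -, h, -⟩, -⟩ ⟨-, -, h'⟩
  linarith

section

variable {p q a b c d : ℤ}

lemma cell_eq_box (hl : d ≤ a) (hr : b - c ≤ 2 * p) (hb : b + d ≤ 0) (ht : -(2 * q) ≤ a + c) :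
    cell p q a b c d = box a b c d := by
  have hl : (d : ℝ) ≤ a := by exact_mod_cast hl
  have hr : (b : ℝ) - c ≤ 2 * p := by exact_mod_cast hr
  have hb : (b : ℝ) + d ≤ 0 := by exact_mod_cast hb
  have ht : -(2 * (q : ℝ)) ≤ a + c := by exact_mod_cast ht
  refine inter_eq_left.2 ?_
  rintro z ⟨h1, h2, h3, h4⟩
  refine ⟨?_, ?_, ?_, ?_⟩ <;> linarith

/-- The left side lies along a diagonal of the square cell and halves it. The right and bottom sides
are brought to this position by maps of determinant ±1. -/
lemma volume_cell_left (hab : a ≤ b) (hr : b - a ≤ 2 * p) (hb : b + b ≤ 0)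
    (ht : -(2 * q) ≤ a + a) :
    volume (cell p q a b a b) = ENNReal.ofReal ((b - a) ^ 2 / 2) := by
  have hr : (b : ℝ) - a ≤ 2 * p := by exact_mod_cast hr
  have hb : (b : ℝ) + b ≤ 0 := by exact_mod_cast hb
  have ht : -(2 * (q : ℝ)) ≤ a + a := by exact_mod_cast ht
  rw [← volume_lower_of_le le_rfl le_rfl hab]
  congr 1
  ext z
  constructor
  · rintro ⟨h, h1, -⟩
    exact ⟨h, by linarith⟩
  · rintro ⟨⟨h1, h2, h3, h4⟩, h5⟩
    refine ⟨⟨h1, h2, h3, h4⟩, ?_, ?_, ?_, ?_⟩ <;> linarith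

lemma volume_cell_right (hab : a ≤ b) (hl : b - 2 * p ≤ a) (hb : b + (b - 2 * p) ≤ 0)
    (ht : -(2 * q) ≤ a + (a - 2 * p)) :
    volume (cell p q a b (a - 2 * p) (b - 2 * p)) = ENNReal.ofReal ((b - a) ^ 2 / 2) := by
  have hl : (b : ℝ) - 2 * p ≤ a := by exact_mod_cast hl
  have hb : (b : ℝ) + (b - 2 * p) ≤ 0 := by exact_mod_cast hb
  have ht : -(2 * (q : ℝ)) ≤ a + (a - 2 * p) := by exact_mod_cast ht
  rw [← volume_lower_of_le le_rfl le_rfl hab,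
    ← volume_preimage_of_det (a := 0) (b := 1) (c := 1) (d := 0) (2 * p) 0 (by simp)
      (lower _ _ _ _)]
  congr 1
  ext z
  simp only [cell, region, lower, box, mem_inter_iff, mem_preimage, mem_ofPred_eq]
  push_cast
  constructor
  · rintro ⟨⟨h1, h2, h3, h4⟩, h5, h6, h7, h8⟩
    refine ⟨⟨?_, ?_, ?_, ?_⟩, ?_⟩ <;> linarith
  · rintro ⟨⟨h1, h2, h3, h4⟩, h5⟩
    refine ⟨⟨?_, ?_, ?_, ?_⟩, ?_, ?_, ?_, ?_⟩ <;> linarith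

lemma volume_cell_bottom (hab : a ≤ b) (hl : -a ≤ a) (hr : b + b ≤ 2 * p)
    (ht : -(2 * q) ≤ a - b) :
    volume (cell p q a b (-b) (-a)) = ENNReal.ofReal ((b - a) ^ 2 / 2) := by
  have hl : -(a : ℝ) ≤ a := by exact_mod_cast hl
  have hr : (b : ℝ) + b ≤ 2 * p := by exact_mod_cast hr
  have ht : -(2 * (q : ℝ)) ≤ a - b := by exact_mod_cast ht
  rw [← volume_lower_of_le le_rfl le_rfl hab,
    ← volume_preimage_of_det (a := 0) (b := -1) (c := 1) (d := 0) 0 0 (by simp)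
      (lower _ _ _ _)]
  congr 1
  ext z
  simp only [cell, region, lower, box, mem_inter_iff, mem_preimage, mem_ofPred_eq]
  push_cast
  constructor
  · rintro ⟨⟨h1, h2, h3, h4⟩, h5, h6, h7, h8⟩
    refine ⟨⟨?_, ?_, ?_, ?_⟩, ?_⟩ <;> linarith
  · rintro ⟨⟨h1, h2, h3, h4⟩, h5⟩
    refine ⟨⟨?_, ?_, ?_, ?_⟩, ?_, ?_, ?_, ?_⟩ <;> linarith

/-- The map z.2 ↦ -2q - z.2 takes the top side to the diagonal but need not send gaps to gaps, so
the two intervals in `lower` may differ. -/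
lemma volume_cell_top (hl : d ≤ a) (hr : b - c ≤ 2 * p) (hb : b + d ≤ 0) :
    volume (cell p q a b c d) = volume (lower a b (-(2 * q) - d) (-(2 * q) - c)) := by
  have hl : (d : ℝ) ≤ a := by exact_mod_cast hl
  have hr : (b : ℝ) - c ≤ 2 * p := by exact_mod_cast hr
  have hb : (b : ℝ) + d ≤ 0 := by exact_mod_cast hb
  rw [← volume_preimage_of_det (a := 1) (b := 0) (c := 0) (d := -1) 0 (-(2 * q)) (by simp)
    (lower _ _ _ _)]
  congr 1
  ext z
  simp only [cell, region, lower, box, mem_inter_iff, mem_preimage, mem_ofPred_eq]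
  push_cast
  constructor
  · rintro ⟨⟨h1, h2, h3, h4⟩, h5, h6, h7, h8⟩
    refine ⟨⟨?_, ?_, ?_, ?_⟩, ?_⟩ <;> linarith
  · rintro ⟨⟨h1, h2, h3, h4⟩, h5⟩
    refine ⟨⟨?_, ?_, ?_, ?_⟩, ?_, ?_, ?_, ?_⟩ <;> linarith

/-- A square of side 2b centred at a corner of the table keeps one quarter, cut out by its two
diagonals; likewise at the other corners. -/
lemma volume_cell_left_bottom (hb : 0 ≤ b) (hr : b ≤ p) (ht : b ≤ q) :
    volume (cell p q (-b) b (-b) b) = ENNReal.ofReal (b ^ 2) := by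
  have hb : 0 ≤ (b : ℝ) := by exact_mod_cast hb
  have hr : (b : ℝ) ≤ p := by exact_mod_cast hr
  have ht : (b : ℝ) ≤ q := by exact_mod_cast ht
  rw [← volume_quarter hb,
    ← volume_preimage_of_det (a := 0) (b := 1) (c := 1) (d := 0) 0 0 (by simp)
      (quarter _)]
  congr 1
  ext z
  simp only [cell, region, quarter, box, mem_inter_iff, mem_preimage, mem_ofPred_eq]
  push_cast
  constructor
  · rintro ⟨⟨h1, h2, h3, h4⟩, h5, h6, h7, h8⟩
    refine ⟨?_, ?_, ?_⟩ <;> linarith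
  · rintro ⟨h1, h2, h3⟩
    refine ⟨⟨?_, ?_, ?_, ?_⟩, ?_, ?_, ?_, ?_⟩ <;> linarith

lemma volume_cell_right_bottom (hb : 0 ≤ b) (hr : b ≤ p) (ht : b ≤ q) :
    volume (cell p q (p - b) (p + b) (-p - b) (-p + b)) = ENNReal.ofReal (b ^ 2) := by
  have hb : 0 ≤ (b : ℝ) := by exact_mod_cast hb
  have hr : (b : ℝ) ≤ p := by exact_mod_cast hr
  have ht : (b : ℝ) ≤ q := by exact_mod_cast ht
  rw [← volume_quarter hb,
    ← volume_preimage_of_det (a := 1) (b := 0) (c := 0) (d := 1) (-p) p (by simp)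
      (quarter _)]
  congr 1
  ext z
  simp only [cell, region, quarter, box, mem_inter_iff, mem_preimage, mem_ofPred_eq]
  push_cast
  constructor
  · rintro ⟨⟨h1, h2, h3, h4⟩, h5, h6, h7, h8⟩
    refine ⟨?_, ?_, ?_⟩ <;> linarith
  · rintro ⟨h1, h2, h3⟩
    refine ⟨⟨?_, ?_, ?_, ?_⟩, ?_, ?_, ?_, ?_⟩ <;> linarith

lemma volume_cell_left_top (hb : 0 ≤ b) (hr : b ≤ p) (ht : b ≤ q) :
    volume (cell p q (-q - b) (-q + b) (-q - b) (-q + b)) = ENNReal.ofReal (b ^ 2) := by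
  have hb : 0 ≤ (b : ℝ) := by exact_mod_cast hb
  have hr : (b : ℝ) ≤ p := by exact_mod_cast hr
  have ht : (b : ℝ) ≤ q := by exact_mod_cast ht
  rw [← volume_quarter hb,
    ← volume_preimage_of_det (a := -1) (b := 0) (c := 0) (d := -1) (-q) (-q) (by simp)
      (quarter _)]
  congr 1
  ext z
  simp only [cell, region, quarter, box, mem_inter_iff, mem_preimage, mem_ofPred_eq]
  push_cast
  constructor
  · rintro ⟨⟨h1, h2, h3, h4⟩, h5, h6, h7, h8⟩
    refine ⟨?_, ?_, ?_⟩ <;> linarith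
  · rintro ⟨h1, h2, h3⟩
    refine ⟨⟨?_, ?_, ?_, ?_⟩, ?_, ?_, ?_, ?_⟩ <;> linarith

lemma volume_cell_right_top (hb : 0 ≤ b) (hr : b ≤ p) (ht : b ≤ q) :
    volume (cell p q (p - q - b) (p - q + b) (-p - q - b) (-p - q + b)) =
      ENNReal.ofReal (b ^ 2) := by
  have hb : 0 ≤ (b : ℝ) := by exact_mod_cast hb
  have hr : (b : ℝ) ≤ p := by exact_mod_cast hr
  have ht : (b : ℝ) ≤ q := by exact_mod_cast ht
  rw [← volume_quarter hb,
    ← volume_preimage_of_det (a := 0) (b := -1) (c := -1) (d := 0) (-p - q) (p - q) (by simp)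
      (quarter _)]
  congr 1
  ext z
  simp only [cell, region, quarter, box, mem_inter_iff, mem_preimage, mem_ofPred_eq]
  push_cast
  constructor
  · rintro ⟨⟨h1, h2, h3, h4⟩, h5, h6, h7, h8⟩
    refine ⟨?_, ?_, ?_⟩ <;> linarith
  · rintro ⟨h1, h2, h3⟩
    refine ⟨⟨?_, ?_, ?_, ?_⟩, ?_, ?_, ?_, ?_⟩ <;> linarith

end

/-! ### Symmetries of the grid and the three gap theorem -/

lemma IsGap.eq_of_overlap {G : Set ℤ} {a b a' b' : ℤ} (h : IsGap G a b) (h' : IsGap G a' b')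
    (h1 : a < b') (h2 : a' < b) : a = a' ∧ b = b' := by
  have h3 := h.2.2.2 a' h'.1
  have h4 := h.2.2.2 b' h'.2.1
  have h5 := h'.2.2.2 a h.1
  have h6 := h'.2.2.2 b h.2.1
  by_contra hc
  rcases lt_trichotomy a a' with h7 | h7 | h7
  · exact h3 h7 h2
  · rcases lt_trichotomy b b' with h8 | h8 | h8
    · exact h6 h2 h8
    · exact hc ⟨h7, h8⟩
    · exact h4 h1 h8
  · exact h5 h7 h1

section

variable {p q m a b c d : ℤ}

lemma IsGap.add (h : IsGap (grid p q m) a b) (k : ℤ) :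
    IsGap (grid p q m) (a + 2 * p * k) (b + 2 * p * k) := by
  refine ⟨grid_add h.1 k, grid_add h.2.1 k, by linarith [h.2.2.1], fun z hz h1 h2 => ?_⟩
  have := h.2.2.2 (z + 2 * p * (-k)) (grid_add hz (-k))
  exact this (by linarith) (by linarith)

lemma IsGap.neg (h : IsGap (grid p q m) a b) : IsGap (grid p q m) (-b) (-a) :=
  ⟨grid_neg h.2.1, grid_neg h.1, by linarith [h.2.2.1], fun z hz h1 h2 =>
    h.2.2.2 (-z) (grid_neg hz) (by linarith) (by linarith)⟩

lemma IsGap.length_le (hp : 0 < p) (h : IsGap (grid p q m) a b) : b - a ≤ 2 * p := by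
  by_contra! hc
  exact h.2.2.2 _ (grid_add h.1 1) (by linarith) (by linarith)

/-- Modulo 2p the grid is a progression of step 2q, so the shift by 2q can fail only at its last
term. All irregularities of the partition come from this. -/
lemma grid_add_two_mul {x : ℤ} (h : x ∈ grid p q m) :
    x + 2 * q ∈ grid p q m ∨ ∃ i, x = q * (m - 1) + 2 * p * i := by
  obtain ⟨s, i, h1, h2, h3, rfl⟩ := h
  rcases h2.eq_or_lt with rfl | h2
  · exact Or.inr ⟨i, rfl⟩
  · rw [Int.even_iff] at h3
    exact Or.inl ⟨s + 2, i, by omega, by omega, by rw [Int.even_iff]; omega, by ring⟩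

lemma grid_sub_two_mul {x : ℤ} (h : x ∈ grid p q m) :
    x - 2 * q ∈ grid p q m ∨ ∃ i, x = -(q * (m - 1)) + 2 * p * i := by
  rcases grid_add_two_mul (grid_neg h) with h' | ⟨i, hi⟩
  · left
    convert grid_neg h' using 1
    ring
  · exact Or.inr ⟨-i, by linarith⟩

/-- One of s = 0 and s = -1 has the parity of m - 1. This is the corner where the orbit starts, so
at most one of the two left corners lies inside a cell. -/
lemma zero_mem_grid_or (hm : 0 < m) : 0 ∈ grid p q m ∨ -q ∈ grid p q m := by
  rcases Int.even_or_odd m with h | h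
  · right
    rw [Int.even_iff] at h
    exact ⟨-1, 0, by omega, by omega, by rw [Int.even_iff]; omega, by ring⟩
  · left
    rw [Int.odd_iff] at h
    exact ⟨0, 0, by omega, by omega, by rw [Int.even_iff]; omega, by ring⟩

lemma not_between_multiples {k : ℤ} (hp : 0 < p) (h1 : 0 < p * k) (h2 : p * k < p) : False := by
  have h3 : 0 < k := pos_of_mul_pos_right h1 hp.le
  nlinarith

/-- Names the only possible value of a quantity; when no instance exists, `default` serves
vacuously. -/
lemma exists_const {ι α : Type*} [Inhabited α] (f : ι → α) (Q : ι → Prop)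
    (h : ∀ x y, Q x → Q y → f x = f y) : ∃ A, ∀ x, Q x → f x = A := by
  by_cases hx : ∃ x, Q x
  · obtain ⟨x, hx⟩ := hx
    exact ⟨f x, fun y hy => h y x hy hx⟩
  · exact ⟨default, fun x h => absurd ⟨x, h⟩ hx⟩

/-- The three gap theorem. -/
lemma three_gaps (p q m : ℤ) : ∃ A B C : ℤ, ∀ a b, IsGap (grid p q m) a b →
    b - a = A ∨ b - a = B ∨ b - a = C := by
  -- `A` is the length of the gap starting at the last term q(m-1) of the progression, `B` of the
  -- gap ending there, and `C` of the gap around -q(m+1), the predecessor of the first term.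
  obtain ⟨A, hA⟩ := exists_const (fun x : ℤ × ℤ => x.2 - x.1)
    (fun x => IsGap (grid p q m) x.1 x.2 ∧ ∃ i, x.1 = q * (m - 1) + 2 * p * i) (by
      rintro ⟨a, b⟩ ⟨a', b'⟩ ⟨h, i, hi⟩ ⟨h', i', hi'⟩
      dsimp only at *
      have h2 := h.add (i' - i)
      have h3 : a + 2 * p * (i' - i) = a' := by rw [hi, hi']; ring
      have := h2.eq_of_overlap h' (by linarith [h'.2.2.1]) (by linarith [h2.2.2.1])
      linarith)
  obtain ⟨B, hB⟩ := exists_const (fun x : ℤ × ℤ => x.2 - x.1)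
    (fun x => IsGap (grid p q m) x.1 x.2 ∧ ∃ i, x.2 = q * (m - 1) + 2 * p * i) (by
      rintro ⟨a, b⟩ ⟨a', b'⟩ ⟨h, i, hi⟩ ⟨h', i', hi'⟩
      dsimp only at *
      have h2 := h.add (i' - i)
      have h3 : b + 2 * p * (i' - i) = b' := by rw [hi, hi']; ring
      have := h2.eq_of_overlap h' (by linarith [h2.2.2.1]) (by linarith [h'.2.2.1])
      linarith)
  obtain ⟨C, hC⟩ := exists_const (fun x : ℤ × ℤ => x.2 - x.1)
    (fun x => IsGap (grid p q m) x.1 x.2 ∧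
      ∃ i, x.1 < -(q * (m + 1)) + 2 * p * i ∧ -(q * (m + 1)) + 2 * p * i < x.2) (by
      rintro ⟨a, b⟩ ⟨a', b'⟩ ⟨h, i, hi⟩ ⟨h', i', hi'⟩
      dsimp only at *
      have h2 := h.add (i' - i)
      have := h2.eq_of_overlap h' (by linarith) (by linarith)
      linarith)
  refine ⟨A, B, C, ?_⟩
  -- Induction on the number `n` of steps of 2q from `a` to the last term: shift the gap by 2q until
  -- it meets an obstruction.
  have key : ∀ (n : ℕ) (a b i : ℤ), IsGap (grid p q m) a b → -(m - 1) ≤ m - 1 - 2 * n →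
      a = q * (m - 1 - 2 * n) + 2 * p * i → b - a = A ∨ b - a = B ∨ b - a = C := by
    intro n
    induction n with
    | zero =>
      intro a b i h _ ha
      exact Or.inl (hA (a, b) ⟨h, i, by rw [ha]; push_cast; ring⟩)
    | succ n ih =>
      intro a b i h hn ha
      push_cast at hn ha
      rcases grid_add_two_mul h.2.1 with hb | hb
      swap
      · exact Or.inr (Or.inl (hB (a, b) ⟨h, hb⟩))
      have ha' : a + 2 * q = q * (m - 1 - 2 * n) + 2 * p * i := by rw [ha]; ring
      -- A level splitting the shifted gap has no predecessor in the grid, so it is the first term;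
      -- shifting back gives type `C`.
      by_cases hz : ∃ z ∈ grid p q m, a + 2 * q < z ∧ z < b + 2 * q
      · obtain ⟨z, hz, h1, h2⟩ := hz
        rcases grid_sub_two_mul hz with h3 | ⟨j, hj⟩
        · exact (h.2.2.2 _ h3 (by linarith) (by linarith)).elim
        · exact Or.inr (Or.inr (hC (a, b) ⟨h, j, by dsimp only; linarith, by
            dsimp only; linarith⟩))
      · have := ih (a + 2 * q) (b + 2 * q) i
          ⟨⟨m - 1 - 2 * n, i, by omega, by omega, by rw [Int.even_iff]; omega, ha'⟩, hb,
            by linarith [h.2.2.1], fun z h1 h2 h3 => hz ⟨z, h1, h2, h3⟩⟩ (by omega) ha'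
        simpa using this
  intro a b h
  obtain ⟨s, i, h1, h2, h3, ha⟩ := id h.1
  rw [Int.even_iff] at h3
  refine key ((m - 1 - s) / 2).toNat a b i h ?_ ?_
  · omega
  · rw [show m - 1 - 2 * (((m - 1 - s) / 2).toNat : ℤ) = s by omega]
    exact ha

/-! ### Classification of the cells and the bound 13 -/

/-- The area of a rectangle with an end of the orbit on one of its sides. -/
def truncArea (a b f : ℤ) : ℝ := ((f : ℝ) - a) ^ 2 / 2 + ((b : ℝ) - f) * (f - a)

/-- The points -q(m+1) + 2pi form one class modulo 2p, so the gaps around them are translates of one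
another. -/
lemma exists_truncArea (p q m : ℤ) : ∃ E : ℝ, ∀ a b i, IsGap (grid p q m) a b →
    a < -(q * (m + 1)) + 2 * p * i → -(q * (m + 1)) + 2 * p * i < b →
    truncArea a b (-(q * (m + 1)) + 2 * p * i) = E := by
  obtain ⟨E, hE⟩ := exists_const (fun x : ℤ × ℤ × ℤ =>
      truncArea x.1 x.2.1 (-(q * (m + 1)) + 2 * p * x.2.2))
    (fun x => IsGap (grid p q m) x.1 x.2.1 ∧
      x.1 < -(q * (m + 1)) + 2 * p * x.2.2 ∧ -(q * (m + 1)) + 2 * p * x.2.2 < x.2.1) (by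
      rintro ⟨a, b, i⟩ ⟨a', b', i'⟩ ⟨h, hi⟩ ⟨h', hi'⟩
      dsimp only at *
      have h2 := h.add (i' - i)
      obtain ⟨rfl, rfl⟩ := h2.eq_of_overlap h' (by linarith) (by linarith)
      unfold truncArea
      push_cast
      ring)
  exact ⟨E, fun a b i h h1 h2 => hE (a, b, i) ⟨h, h1, h2⟩⟩

lemma exists_volume_cell (p q m x y : ℤ) : ∃ V : ENNReal, ∀ a b c d, IsGap (grid p q m) a b →
    IsGap (grid p q m) c d → a < x → x < b → c < y → y < d → volume (cell p q a b c d) = V := by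
  obtain ⟨V, hV⟩ := exists_const (fun x : ℤ × ℤ × ℤ × ℤ =>
      volume (cell p q x.1 x.2.1 x.2.2.1 x.2.2.2))
    (fun w => IsGap (grid p q m) w.1 w.2.1 ∧ IsGap (grid p q m) w.2.2.1 w.2.2.2 ∧
      w.1 < x ∧ x < w.2.1 ∧ w.2.2.1 < y ∧ y < w.2.2.2) (by
      rintro ⟨a, b, c, d⟩ ⟨a', b', c', d'⟩ ⟨h, h', h1, h2, h3, h4⟩ ⟨k, k', k1, k2, k3, k4⟩
      dsimp only at *
      obtain ⟨rfl, rfl⟩ := h.eq_of_overlap k (by linarith) (by linarith)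
      obtain ⟨rfl, rfl⟩ := h'.eq_of_overlap k' (by linarith) (by linarith)
      rfl)
  exact ⟨V, fun a b c d h h' h1 h2 h3 h4 => hV (a, b, c, d) ⟨h, h', h1, h2, h3, h4⟩⟩

lemma cell_nonempty_bounds (h : (cell p q a b c d).Nonempty) :
    c < b ∧ a - d < 2 * p ∧ a + c < 0 ∧ -(2 * q) < b + d := by
  obtain ⟨z, ⟨h1, h2, h3, h4⟩, h5, h6, h7, h8⟩ := h
  have k1 : (c : ℝ) < b := by linarith
  have k2 : (a : ℝ) - d < 2 * p := by linarith
  have k3 : (a : ℝ) + c < 0 := by linarith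
  have k4 : -(2 * (q : ℝ)) < b + d := by linarith
  exact ⟨by exact_mod_cast k1, by exact_mod_cast k2, by exact_mod_cast k3, by exact_mod_cast k4⟩

/-- The point `(x, y)` lies in the rectangle. -/
def Encloses (a b c d x y : ℤ) : Prop := a < x ∧ x < b ∧ c < y ∧ y < d

/-- The rectangle contains a corner of the table. -/
def EnclosesCorner (p q a b c d : ℤ) : Prop :=
  Encloses a b c d 0 0 ∨ Encloses a b c d p (-p) ∨ Encloses a b c d (-q) (-q) ∨
    Encloses a b c d (p - q) (-p - q)

/-- A cell with points strictly on both sides of the line z.1 = z.2 comes from two overlapping gaps,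
which must coincide. The right and bottom sides work the same way after a translation by 2p or a
negation. -/
lemma left_cut (h : IsGap (grid p q m) a b) (h' : IsGap (grid p q m) c d) (hn : c < b)
    (hl : a < d) : c = a ∧ d = b := by
  obtain ⟨rfl, rfl⟩ := h.eq_of_overlap h' hl hn
  exact ⟨rfl, rfl⟩

lemma right_cut (h : IsGap (grid p q m) a b) (h' : IsGap (grid p q m) c d) (hn : a - d < 2 * p)
    (hl : 2 * p < b - c) : c = a - 2 * p ∧ d = b - 2 * p := by
  have := h.eq_of_overlap (h'.add 1) (by linarith) (by linarith)
  exact ⟨by linarith, by linarith⟩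

lemma bottom_cut (h : IsGap (grid p q m) a b) (h' : IsGap (grid p q m) c d) (hn : a + c < 0)
    (hl : 0 < b + d) : c = -b ∧ d = -a := by
  have := h.eq_of_overlap h'.neg (by linarith) (by linarith)
  exact ⟨by linarith, by linarith⟩

/-- Neither endpoint can move by 2q into the gap, so modulo 2p the left one is the last term and the
right one the first; these are opposite. -/
lemma IsGap.symmetric_of_long (hq : 0 < q) (h : IsGap (grid p q m) a b) (hl : 2 * q < b - a) :
    ∃ k, a + b = 2 * p * k := by
  rcases grid_add_two_mul h.1 with h1 | ⟨i, hi⟩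
  · exact (h.2.2.2 _ h1 (by linarith) (by linarith)).elim
  rcases grid_sub_two_mul h.2.1 with h1 | ⟨j, hj⟩
  · exact (h.2.2.2 _ h1 (by linarith) (by linarith)).elim
  exact ⟨i + j, by rw [hi, hj]; ring⟩

/-- Such a cell comes from a gap longer than 2q, so its centre is (pk, -pk); meeting the table
leaves k = 0 or 1, the two bottom corners. -/
lemma enclosesCorner_of_bottom_top (hp : 0 < p) (hq : 0 < q) (h : IsGap (grid p q m) a b)
    (hn : (cell p q a b (-b) (-a)).Nonempty) (ht : a - b < -(2 * q)) :
    EnclosesCorner p q a b (-b) (-a) := by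
  obtain ⟨k, hk⟩ := h.symmetric_of_long hq (by linarith)
  obtain ⟨h1, h2, -, -⟩ := cell_nonempty_bounds hn
  have h3 := h.length_le hp
  have h4 := h.2.2.1
  have h5 : -1 < k := by
    by_contra! hc
    nlinarith
  have h6 : k < 2 := by
    by_contra! hc
    nlinarith
  obtain rfl | rfl : k = 0 ∨ k = 1 := by omega
  · left
    refine ⟨?_, ?_, ?_, ?_⟩ <;> linarith
  · right; left
    refine ⟨?_, ?_, ?_, ?_⟩ <;> linarith

/-- The possible areas of cells that are cut by the top of the table only. -/
lemma volume_lower_cases (hp : 0 < p) {x y : ℤ} (h : IsGap (grid p q m) a b)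
    (h' : IsGap (grid p q m) (x + 2 * q) (y + 2 * q)) (hay : a < y) (hxb : x < b)
    (hl : -(2 * q) - x ≤ a) (hr : b + y + 2 * q ≤ 2 * p) :
    (∃ a' b', IsGap (grid p q m) a' b' ∧
      volume (lower a b x y) = ENNReal.ofReal (((b' : ℝ) - a') ^ 2 / 2)) ∨
    ∃ a' b' i, IsGap (grid p q m) a' b' ∧ a' < -(q * (m + 1)) + 2 * p * i ∧
      -(q * (m + 1)) + 2 * p * i < b' ∧ volume (lower a b x y) =
        ENNReal.ofReal (truncArea a' b' (-(q * (m + 1)) + 2 * p * i)) := by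
  have hxy : x < y := by linarith [h'.2.2.1]
  have hab := h.2.2.1
  have hlen := h.length_le hp
  have hlen' : y - x ≤ 2 * p := by linarith [h'.length_le hp]
  -- An endpoint of one interval strictly inside the other must be an end of the progression. Two
  -- such endpoints would yield a multiple of p strictly between 0 and p, which leaves only
  -- intervals with a common endpoint.
  have hin : ∀ z, z + 2 * q ∈ grid p q m → a < z → z < b →
      ∃ i, z = -(q * (m + 1)) + 2 * p * i := by
    intro z hz h1 h2
    rcases grid_sub_two_mul hz with h3 | ⟨i, hi⟩
    · exact (h.2.2.2 z (by simpa using h3) h1 h2).elim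
    · exact ⟨i, by linarith⟩
  have hin' : ∀ z ∈ grid p q m, x < z → z < y → ∃ i, z = q * (m - 1) + 2 * p * i := by
    intro z hz h1 h2
    rcases grid_add_two_mul hz with h3 | h3
    · exact (h'.2.2.2 _ h3 (by linarith) (by linarith)).elim
    · exact h3
  rcases lt_trichotomy a x with hax | rfl | hxa
  · obtain ⟨i, hi⟩ := hin x h'.1 hax hxb
    rcases lt_trichotomy b y with hby | rfl | hyb
    · obtain ⟨j, hj⟩ := hin' b h.2.1 hxb hby
      have h3 : b + x = -(2 * q) + 2 * (p * (i + j)) := by rw [hi, hj]; ring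
      exact (not_between_multiples (k := i + j) hp (by linarith) (by linarith)).elim
    · left
      refine ⟨_, _, h', ?_⟩
      rw [volume_lower_of_le hax.le le_rfl hxb.le]
      push_cast
      congr 2
      ring
    · obtain ⟨j, hj⟩ := hin y h'.2.1 hay hyb
      have h3 : y - x = 2 * (p * (j - i)) := by rw [hi, hj]; ring
      exact (not_between_multiples (k := j - i) hp (by linarith) (by linarith)).elim
  · rcases le_or_gt b y with hby | hyb
    · exact Or.inl ⟨_, _, h, volume_lower_of_le le_rfl hby hab.le⟩
    · obtain ⟨i, hi⟩ := hin y h'.2.1 hay hyb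
      right
      refine ⟨a, b, i, h, by linarith, by linarith, ?_⟩
      rw [volume_lower_left hay.le hyb.le, ← hi]
      rfl
  · obtain ⟨i, hi⟩ := hin' a h.1 hxa hay
    rcases lt_trichotomy b y with hby | rfl | hyb
    · obtain ⟨j, hj⟩ := hin' b h.2.1 hxb hby
      have h3 : b - a = 2 * (p * (j - i)) := by rw [hi, hj]; ring
      exact (not_between_multiples (k := j - i) hp (by linarith) (by linarith)).elim
    · right
      have hf : -(q * (m + 1)) + 2 * p * (-i) = -a - 2 * q := by rw [hi]; ring
      refine ⟨_, _, -i, h'.neg, by linarith, by linarith, ?_⟩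
      rw [volume_lower_right hxa.le hab.le, hf, truncArea]
      push_cast
      congr 1
      ring
    · obtain ⟨j, hj⟩ := hin y h'.2.1 hay hyb
      have h3 : a + y = -(2 * q) + 2 * (p * (i + j)) := by rw [hi, hj]; ring
      exact (not_between_multiples (k := i + j) hp (by linarith) (by linarith)).elim

/-- A cell cut by the left, right or bottom side is a square halved by it unless a second side cuts
it as well, and then it contains a corner. Cells cut by the top side alone are left to
`volume_lower_cases`. -/
lemma volume_cell_cases (hp : 0 < p) (hq : 0 < q) (h : IsGap (grid p q m) a b)
    (h' : IsGap (grid p q m) c d) (hn : (cell p q a b c d).Nonempty) :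
    volume (cell p q a b c d) = ENNReal.ofReal (((b : ℝ) - a) * (d - c)) ∨
    (∃ a' b', IsGap (grid p q m) a' b' ∧
      volume (cell p q a b c d) = ENNReal.ofReal (((b' : ℝ) - a') ^ 2 / 2)) ∨
    EnclosesCorner p q a b c d ∨
    ∃ a' b' i, IsGap (grid p q m) a' b' ∧ a' < -(q * (m + 1)) + 2 * p * i ∧
      -(q * (m + 1)) + 2 * p * i < b' ∧ volume (cell p q a b c d) =
        ENNReal.ofReal (truncArea a' b' (-(q * (m + 1)) + 2 * p * i)) := by
  obtain ⟨n1, n2, n3, n4⟩ := cell_nonempty_bounds hn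
  have hab := h.2.2.1
  have hlen := h.length_le hp
  rcases lt_or_ge a d with hl | hl
  · obtain ⟨rfl, rfl⟩ := left_cut h h' n1 hl
    rcases lt_or_ge 0 (d + d) with hb | hb
    · exact Or.inr (Or.inr (Or.inl (Or.inl ⟨by linarith, by linarith, by linarith, by linarith⟩)))
    rcases lt_or_ge (c + c) (-(2 * q)) with ht | ht
    · exact Or.inr (Or.inr (Or.inl (Or.inr (Or.inr (Or.inl
        ⟨by linarith, by linarith, by linarith, by linarith⟩)))))
    exact Or.inr (Or.inl ⟨_, _, h, volume_cell_left hab.le hlen hb ht⟩)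
  rcases lt_or_ge (2 * p) (b - c) with hr | hr
  · obtain ⟨rfl, rfl⟩ := right_cut h h' n2 hr
    rcases lt_or_ge 0 (b + (b - 2 * p)) with hb | hb
    · exact Or.inr (Or.inr (Or.inl (Or.inr (Or.inl
        ⟨by linarith, by linarith, by linarith, by linarith⟩))))
    rcases lt_or_ge (a + (a - 2 * p)) (-(2 * q)) with ht | ht
    · exact Or.inr (Or.inr (Or.inl (Or.inr (Or.inr (Or.inr
        ⟨by linarith, by linarith, by linarith, by linarith⟩)))))
    exact Or.inr (Or.inl ⟨_, _, h, volume_cell_right hab.le hl hb ht⟩)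
  rcases lt_or_ge 0 (b + d) with hb | hb
  · obtain ⟨rfl, rfl⟩ := bottom_cut h h' n3 hb
    rcases lt_or_ge (a - b) (-(2 * q)) with ht | ht
    · exact Or.inr (Or.inr (Or.inl (enclosesCorner_of_bottom_top hp hq h hn ht)))
    exact Or.inr (Or.inl ⟨_, _, h, volume_cell_bottom hab.le hl (by linarith) ht⟩)
  rcases lt_or_ge (a + c) (-(2 * q)) with ht | ht
  · have h2 : IsGap (grid p q m) (-(2 * q) - d + 2 * q) (-(2 * q) - c + 2 * q) := by
      convert h'.neg using 1 <;> ring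
    rw [volume_cell_top hl hr hb]
    rcases volume_lower_cases hp h h2 (by linarith) (by linarith) (by linarith) (by linarith) with
      h3 | h3
    · exact Or.inr (Or.inl h3)
    · exact Or.inr (Or.inr (Or.inr h3))
  · left
    rw [cell_eq_box hl hr hb ht, volume_box hab.le]

/-- Six products of gap lengths, three half squares, three corner cells (the left corners share
`V₃`) and the exceptional `E`. -/
lemma encard_cellVolumes_le (hp : 0 < p) (hq : 0 < q) (hm : 0 < m) :
    (cellVolumes p q m).encard ≤ 13 := by
  obtain ⟨A, B, C, hABC⟩ := three_gaps p q m
  obtain ⟨E, hE⟩ := exists_truncArea p q m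
  obtain ⟨V₁, hV₁⟩ := exists_volume_cell p q m p (-p)
  obtain ⟨V₂, hV₂⟩ := exists_volume_cell p q m (p - q) (-p - q)
  obtain ⟨V₃, hV₃⟩ : ∃ V : ENNReal, ∀ a b c d, IsGap (grid p q m) a b →
      IsGap (grid p q m) c d → Encloses a b c d 0 0 ∨ Encloses a b c d (-q) (-q) →
      volume (cell p q a b c d) = V := by
    rcases zero_mem_grid_or (p := p) (q := q) hm with h0 | h0
    · obtain ⟨V, hV⟩ := exists_volume_cell p q m (-q) (-q)
      refine ⟨V, fun a b c d h h' hc => ?_⟩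
      rcases hc with ⟨h1, h2, -⟩ | ⟨h1, h2, h3, h4⟩
      · exact (h.2.2.2 _ h0 h1 h2).elim
      · exact hV a b c d h h' h1 h2 h3 h4
    · obtain ⟨V, hV⟩ := exists_volume_cell p q m 0 0
      refine ⟨V, fun a b c d h h' hc => ?_⟩
      rcases hc with ⟨h1, h2, h3, h4⟩ | ⟨h1, h2, -⟩
      · exact hV a b c d h h' h1 h2 h3 h4
      · exact (h.2.2.2 _ h0 h1 h2).elim
  let L : List ENNReal := [ENNReal.ofReal (A * A), ENNReal.ofReal (A * B),
    ENNReal.ofReal (A * C), ENNReal.ofReal (B * B), ENNReal.ofReal (B * C),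
    ENNReal.ofReal (C * C), ENNReal.ofReal ((A : ℝ) ^ 2 / 2), ENNReal.ofReal ((B : ℝ) ^ 2 / 2),
    ENNReal.ofReal ((C : ℝ) ^ 2 / 2), V₁, V₂, V₃, ENNReal.ofReal E]
  classical
  have hL : cellVolumes p q m ⊆ (L.toFinset : Set ENNReal) := by
    rintro V ⟨a, b, c, d, h, h', hn, rfl⟩
    rw [List.coe_toFinset, mem_ofPred_eq]
    have hcast : ∀ {a b A : ℤ}, b - a = A → (b : ℝ) - a = A := fun h => by
      rw [← h]; push_cast; ring
    rcases volume_cell_cases hp hq h h' hn with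
      hv | ⟨a', b', h2, hv⟩ | hv | ⟨a', b', i, h2, k1, k2, hv⟩
    · rw [hv]
      rcases hABC a b h with k | k | k <;> rcases hABC c d h' with k' | k' | k' <;>
        rw [hcast k, hcast k'] <;> simp [L, mul_comm]
    · rw [hv]
      rcases hABC a' b' h2 with k | k | k <;> rw [hcast k] <;> simp [L]
    · rcases hv with hv | hv | hv | hv
      · rw [hV₃ a b c d h h' (Or.inl hv)]; simp [L]
      · rw [hV₁ a b c d h h' hv.1 hv.2.1 hv.2.2.1 hv.2.2.2]; simp [L]
      · rw [hV₃ a b c d h h' (Or.inr hv)]; simp [L]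
      · rw [hV₂ a b c d h h' hv.1 hv.2.1 hv.2.2.1 hv.2.2.2]; simp [L]
    · rw [hv, hE a' b' i h2 k1 k2]; simp [L]
  refine (encard_le_encard hL).trans ?_
  rw [encard_coe_eq_coe_finsetCard]
  exact_mod_cast L.toFinset_card_le

end

/-! ### Thirteen areas for slope 22/27 -/

lemma mem_cellVolumes {p q m a b c d : ℤ} {x : ℝ} (h : IsGap (grid p q m) a b)
    (h' : IsGap (grid p q m) c d) (hx : 0 < x)
    (hV : volume (cell p q a b c d) = ENNReal.ofReal x) :
    ENNReal.ofReal x ∈ cellVolumes p q m :=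
  ⟨a, b, c, d, h, h', nonempty_of_measure_ne_zero (μ := volume) (by
    rw [hV, Ne, ENNReal.ofReal_eq_zero, not_le]; exact hx), hV.symm⟩

lemma mem_grid_22_27_7 (x : ℤ) : x ∈ grid 22 27 7 ↔ x % 44 = 0 ∨ x % 44 = 10 ∨ x % 44 = 14 ∨
    x % 44 = 20 ∨ x % 44 = 24 ∨ x % 44 = 30 ∨ x % 44 = 34 := by
  constructor
  · rintro ⟨s, i, h1, h2, h3, rfl⟩
    obtain ⟨t, rfl⟩ : ∃ t, s = 2 * t := ⟨s / 2, by rw [Int.even_iff] at h3; omega⟩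
    have h4 : -3 ≤ t := by omega
    have h5 : t ≤ 3 := by omega
    interval_cases t <;> omega
  · have key : ∀ s : ℤ, -6 ≤ s → s ≤ 6 → s % 2 = 0 → (x - 27 * s) % 44 = 0 →
        x ∈ grid 22 27 7 := fun s h1 h2 h3 h4 =>
      ⟨s, (x - 27 * s) / 44, by omega, by omega, by rw [Int.even_iff]; omega, by omega⟩
    rintro (h | h | h | h | h | h | h)
    · exact key 0 (by omega) (by omega) (by omega) (by omega)
    · exact key 2 (by omega) (by omega) (by omega) (by omega)
    · exact key (-6) (by omega) (by omega) (by omega) (by omega)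
    · exact key 4 (by omega) (by omega) (by omega) (by omega)
    · exact key (-4) (by omega) (by omega) (by omega) (by omega)
    · exact key 6 (by omega) (by omega) (by omega) (by omega)
    · exact key (-2) (by omega) (by omega) (by omega) (by omega)

lemma isGap_22_27_7 {a b : ℤ} (ha : a ∈ grid 22 27 7) (h : a % 44 = 0 ∧ b = a + 10 ∨
    a % 44 = 10 ∧ b = a + 4 ∨ a % 44 = 14 ∧ b = a + 6 ∨ a % 44 = 20 ∧ b = a + 4 ∨
    a % 44 = 24 ∧ b = a + 6 ∨ a % 44 = 30 ∧ b = a + 4 ∨ a % 44 = 34 ∧ b = a + 10) :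
    IsGap (grid 22 27 7) a b := by
  refine ⟨ha, ?_, by omega, fun z hz h1 h2 => ?_⟩
  · rw [mem_grid_22_27_7]; omega
  · rw [mem_grid_22_27_7] at hz; omega

lemma le_encard_cellVolumes_22_27_7 : 13 ≤ (cellVolumes 22 27 7).encard := by
  have gap : ∀ a b : ℤ, (a % 44 = 0 ∧ b = a + 10 ∨
      a % 44 = 10 ∧ b = a + 4 ∨ a % 44 = 14 ∧ b = a + 6 ∨ a % 44 = 20 ∧ b = a + 4 ∨
      a % 44 = 24 ∧ b = a + 6 ∨ a % 44 = 30 ∧ b = a + 4 ∨ a % 44 = 34 ∧ b = a + 10) →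
      IsGap (grid 22 27 7) a b := fun a b h =>
    isGap_22_27_7 (by rw [mem_grid_22_27_7]; omega) h
  -- The gap lengths are 4, 6, 10: products 16, 24, 36, 40, 60, 100; half squares 8, 18, 50; corner
  -- cells 4, 9, 25; exceptional area 32.
  let F : Finset ℕ := {4, 8, 9, 16, 18, 24, 25, 32, 36, 40, 50, 60, 100}
  have hbox : ∀ {a b c d : ℤ} (n : ℕ), IsGap (grid 22 27 7) a b → IsGap (grid 22 27 7) c d →
      d ≤ a → b - c ≤ 2 * 22 → b + d ≤ 0 → -(2 * 27) ≤ a + c → 0 < n →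
      (b - a) * (d - c) = n → ENNReal.ofReal n ∈ cellVolumes 22 27 7 := by
    intro a b c d n h h' hl hr hb ht hn hV
    refine mem_cellVolumes h h' (by exact_mod_cast hn) ?_
    rw [cell_eq_box hl hr hb ht, volume_box h.2.2.1.le]
    congr 1
    exact_mod_cast hV
  have hbot : ∀ {a b : ℤ} (n : ℕ), IsGap (grid 22 27 7) a b →
      -a ≤ a → b + b ≤ 2 * 22 → -(2 * 27) ≤ a - b → 0 < n →
      (b - a) ^ 2 = 2 * n → ENNReal.ofReal n ∈ cellVolumes 22 27 7 := by
    intro a b n h hl hr ht hn hV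
    refine mem_cellVolumes h h.neg (by exact_mod_cast hn) ?_
    rw [volume_cell_bottom h.2.2.1.le hl hr ht]
    congr 1
    have : ((b : ℝ) - a) ^ 2 = 2 * n := by exact_mod_cast hV
    rw [this]
    ring
  have hF : ∀ n ∈ F, ENNReal.ofReal (n : ℕ) ∈ cellVolumes 22 27 7 := by
    intro n hn
    simp only [F, Finset.mem_insert, Finset.mem_singleton] at hn
    rcases hn with rfl | rfl | rfl | rfl | rfl | rfl | rfl | rfl | rfl | rfl | rfl | rfl | rfl
    · refine mem_cellVolumes (gap 20 24 (by omega)) (gap (-24) (-20) (by omega)) (by norm_num) ?_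
      have := volume_cell_right_bottom (p := 22) (q := 27) (b := 2) (by norm_num) (by norm_num)
        (by norm_num)
      norm_num at this ⊢
      exact this
    · exact hbot 8 (gap 10 14 (by omega)) (by norm_num) (by norm_num) (by norm_num) (by norm_num)
        (by norm_num)
    · refine mem_cellVolumes (gap (-30) (-24) (by omega)) (gap (-30) (-24) (by omega))
        (by norm_num) ?_
      have := volume_cell_left_top (p := 22) (q := 27) (b := 3) (by norm_num) (by norm_num)
        (by norm_num)
      norm_num at this ⊢
      exact this
    · exact hbox 16 (gap 10 14 (by omega)) (gap (-24) (-20) (by omega)) (by norm_num)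
        (by norm_num) (by norm_num) (by norm_num) (by norm_num) (by norm_num)
    · exact hbot 18 (gap 14 20 (by omega)) (by norm_num) (by norm_num) (by norm_num) (by norm_num)
        (by norm_num)
    · exact hbox 24 (gap 14 20 (by omega)) (gap (-24) (-20) (by omega)) (by norm_num)
        (by norm_num) (by norm_num) (by norm_num) (by norm_num) (by norm_num)
    · refine mem_cellVolumes (gap (-10) 0 (by omega)) (gap (-54) (-44) (by omega))
        (by norm_num) ?_
      have := volume_cell_right_top (p := 22) (q := 27) (b := 5) (by norm_num) (by norm_num)
        (by norm_num)
      norm_num at this ⊢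
      exact this
    -- The exceptional cell: reflection in the top side takes (-44, -34) to (-20, -10), which
    -- properly contains (-14, -10); the area is 4²/2 + 4·6.
    · refine mem_cellVolumes (gap (-14) (-10) (by omega)) (gap (-44) (-34) (by omega))
        (by norm_num) ?_
      rw [volume_cell_top (by norm_num) (by norm_num) (by norm_num)]
      have := volume_lower_right (a := -14) (b := -10) (c := -20) (by norm_num) (by norm_num)
      norm_num at this ⊢
      exact this
    · exact hbox 36 (gap (-20) (-14) (by omega)) (gap (-30) (-24) (by omega)) (by norm_num)
        (by norm_num) (by norm_num) (by norm_num) (by norm_num) (by norm_num)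
    · exact hbox 40 (gap 0 10 (by omega)) (gap (-14) (-10) (by omega)) (by norm_num)
        (by norm_num) (by norm_num) (by norm_num) (by norm_num) (by norm_num)
    · exact hbot 50 (gap 0 10 (by omega)) (by norm_num) (by norm_num) (by norm_num) (by norm_num)
        (by norm_num)
    · exact hbox 60 (gap 0 10 (by omega)) (gap (-20) (-14) (by omega)) (by norm_num)
        (by norm_num) (by norm_num) (by norm_num) (by norm_num) (by norm_num)
    · exact hbox 100 (gap (-10) 0 (by omega)) (gap (-44) (-34) (by omega)) (by norm_num)
        (by norm_num) (by norm_num) (by norm_num) (by norm_num) (by norm_num)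
  have hsub : (fun n : ℕ => (n : ENNReal)) '' (F : Set ℕ) ⊆ cellVolumes 22 27 7 := by
    rintro _ ⟨n, hn, rfl⟩
    have := hF n hn
    rwa [ENNReal.ofReal_natCast] at this
  refine le_trans ?_ (encard_le_encard hsub)
  rw [Nat.cast_injective.encard_image, encard_coe_eq_coe_finsetCard]
  rfl

/-! ### The complete orbit: diamonds around integer points -/

section

variable {p q a b c d : ℤ}

/-- Since q is invertible modulo p, the p terms of step 2q run through all residues modulo 2p of one
parity. -/
lemma mem_grid_full (hp : 0 < p) (hpq : IsCoprime p q) {x : ℤ} :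
    x ∈ grid p q p ↔ Even (x - q * (p - 1)) := by
  constructor
  · rintro ⟨s, i, -, -, h, rfl⟩
    have : q * s + 2 * p * i - q * (p - 1) = q * (s - (p - 1)) + 2 * (p * i) := by ring
    rw [this]
    exact (h.mul_left q).add (even_two_mul _)
  · rintro ⟨w, hw⟩
    obtain ⟨u, v, huv⟩ := hpq
    have h1 := Int.emod_add_mul_ediv (-(v * w)) p
    have h2 := Int.emod_nonneg (-(v * w)) hp.ne'
    have h3 := Int.emod_lt_of_pos (-(v * w)) hp
    set j := -(v * w) % p with hj
    set e := -(v * w) / p with he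
    -- With x = q(p-1) + 2w one needs w = -qj + pi. Bézout gives j ≡ -vw (mod p), and reduction
    -- modulo p puts `j` in [0, p).
    refine ⟨p - 1 - 2 * j, u * w - q * e, by omega, by omega, ⟨-j, by ring⟩, ?_⟩
    have h4 : x = q * (p - 1) + 2 * w := by linarith
    rw [h4, show j = -(v * w) - p * e by linarith]
    linear_combination (-2 * w) * huv

lemma isGap_full_iff (hp : 0 < p) (hpq : IsCoprime p q) :
    IsGap (grid p q p) a b ↔ Even (a - q * (p - 1)) ∧ b = a + 2 := by
  constructor
  · rintro ⟨h1, h2, h3, h4⟩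
    rw [mem_grid_full hp hpq] at h1 h2
    refine ⟨h1, ?_⟩
    have h5 : ¬ a + 2 < b := h4 (a + 2) ((mem_grid_full hp hpq).2 (by
      rw [Int.even_iff] at *; omega)) (by omega)
    rw [Int.even_iff] at h1 h2
    omega
  · rintro ⟨h1, rfl⟩
    refine ⟨(mem_grid_full hp hpq).2 h1, (mem_grid_full hp hpq).2 ?_, by omega, fun z hz => ?_⟩
    · rw [Int.even_iff] at *; omega
    · rw [mem_grid_full hp hpq] at hz
      rw [Int.even_iff] at *; omega

open Classical in
/-- The area of a diamond centred at `(x, y)` in the table, in diagonal coordinates. -/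
def diamondArea (p q x y : ℤ) : ℝ :=
  if x = 0 ∨ x = p then if y = 0 ∨ y = q then 1 else 2 else if y = 0 ∨ y = q then 2 else 4

lemma volume_cell_full (hp : 0 < p) (hq : 0 < q) {x y : ℤ} (hx : 0 ≤ x) (hxp : x ≤ p)
    (hy : 0 ≤ y) (hyq : y ≤ q) :
    volume (cell p q (x - y - 1) (x - y + 1) (-x - y - 1) (-x - y + 1)) =
      ENNReal.ofReal (diamondArea p q x y) := by
  unfold diamondArea
  split_ifs with h1 h2 h2
  · rcases h1 with rfl | rfl <;> rcases h2 with rfl | rfl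
    · have := volume_cell_left_bottom (p := p) (q := q) (b := 1) (by omega) (by omega) (by omega)
      norm_num at this ⊢
      exact this
    · have := volume_cell_left_top (p := p) (q := y) (b := 1) (by omega) (by omega) (by omega)
      norm_num at this ⊢
      exact this
    · have := volume_cell_right_bottom (p := x) (q := q) (b := 1) (by omega) (by omega) (by omega)
      norm_num at this ⊢
      exact this
    · have := volume_cell_right_top (p := x) (q := y) (b := 1) (by omega) (by omega) (by omega)
      norm_num at this ⊢
      exact this
  · rw [not_or] at h2
    rcases h1 with rfl | rfl
    · have := volume_cell_left (p := p) (q := q) (a := 0 - y - 1) (b := 0 - y + 1) (by omega)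
        (by omega) (by omega) (by omega)
      norm_num at this ⊢
      rw [this]
    · have := volume_cell_right (p := x) (q := q) (a := x - y - 1) (b := x - y + 1) (by omega)
        (by omega) (by omega) (by omega)
      rw [show -x - y - 1 = x - y - 1 - 2 * x by ring, show -x - y + 1 = x - y + 1 - 2 * x by ring,
        this]
      push_cast
      ring_nf
  · rw [not_or] at h1
    rcases h2 with rfl | rfl
    · have := volume_cell_bottom (p := p) (q := q) (a := x - 0 - 1) (b := x - 0 + 1) (by omega)
        (by omega) (by omega) (by omega)
      rw [show -x - 0 - 1 = -(x - 0 + 1) by ring, show -x - 0 + 1 = -(x - 0 - 1) by ring, this]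
      push_cast
      ring_nf
    · rw [volume_cell_top (by omega) (by omega) (by omega), volume_lower_of_le (by omega) (by omega)
        (by omega)]
      push_cast
      ring_nf
  · rw [not_or] at h1 h2
    rw [cell_eq_box (by omega) (by omega) (by omega) (by omega), volume_box (by omega)]
    push_cast
    ring_nf

lemma exists_center (hp : 0 < p) (hpq : IsCoprime p q)
    (h : IsGap (grid p q p) a b) (h' : IsGap (grid p q p) c d)
    (hn : (cell p q a b c d).Nonempty) :
    ∃ x y : ℤ, 0 ≤ x ∧ x ≤ p ∧ 0 ≤ y ∧ y ≤ q ∧ a = x - y - 1 ∧ b = x - y + 1 ∧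
      c = -x - y - 1 ∧ d = -x - y + 1 := by
  obtain ⟨h1, rfl⟩ := (isGap_full_iff hp hpq).1 h
  obtain ⟨h2, rfl⟩ := (isGap_full_iff hp hpq).1 h'
  obtain ⟨k1, k2, k3, k4⟩ := cell_nonempty_bounds hn
  rw [Int.even_iff] at h1 h2
  refine ⟨(a - c) / 2, -((a + c + 2) / 2), ?_, ?_, ?_, ?_, ?_, ?_, ?_, ?_⟩ <;> omega

lemma diamondArea_cases (p q x y : ℤ) :
    diamondArea p q x y = 1 ∨ diamondArea p q x y = 2 ∨ diamondArea p q x y = 4 := by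
  unfold diamondArea
  split_ifs <;> simp

lemma cellVolumes_full_subset (hp : 0 < p) (hq : 0 < q) (hpq : IsCoprime p q) :
    cellVolumes p q p ⊆ {ENNReal.ofReal 1, ENNReal.ofReal 2, ENNReal.ofReal 4} := by
  rintro V ⟨a, b, c, d, h, h', hn, rfl⟩
  obtain ⟨x, y, hx, hxp, hy, hyq, rfl, rfl, rfl, rfl⟩ := exists_center hp hpq h h' hn
  rw [volume_cell_full hp hq hx hxp hy hyq]
  rcases diamondArea_cases p q x y with h | h | h <;> simp [h]

lemma encard_cellVolumes_full_le (hp : 0 < p) (hq : 0 < q) (hpq : IsCoprime p q) :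
    (cellVolumes p q p).encard ≤ 3 := by
  refine (encard_le_encard (cellVolumes_full_subset hp hq hpq)).trans ?_
  refine (encard_insert_le _ _).trans ?_
  refine (add_le_add_left (encard_insert_le _ _) 1).trans ?_
  rw [encard_singleton]
  norm_num

lemma diamondArea_mem_cellVolumes (hp : 0 < p) (hq : 0 < q) (hpq : IsCoprime p q) {x y : ℤ}
    (hx : 0 ≤ x) (hxp : x ≤ p) (hy : 0 ≤ y) (hyq : y ≤ q)
    (h : Even (x - y - 1 - q * (p - 1))) :
    ENNReal.ofReal (diamondArea p q x y) ∈ cellVolumes p q p := by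
  have hV := volume_cell_full hp hq hx hxp hy hyq
  refine ⟨x - y - 1, x - y + 1, -x - y - 1, -x - y + 1, (isGap_full_iff hp hpq).2 ⟨h, by ring⟩,
    (isGap_full_iff hp hpq).2 ⟨?_, by ring⟩, nonempty_of_measure_ne_zero (μ := volume) ?_, hV.symm⟩
  · rw [Int.even_iff] at *; omega
  · rw [hV, Ne, ENNReal.ofReal_eq_zero, not_le]
    rcases diamondArea_cases p q x y with h | h | h <;> simp [h]

/-- The corner (p, 0) is always the centre of a diamond: (p-1)(1-q) is even because p and q are not
both even. -/
lemma one_mem_cellVolumes_full (hp : 0 < p) (hq : 0 < q) (hpq : IsCoprime p q) :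
    ENNReal.ofReal 1 ∈ cellVolumes p q p := by
  have h1 : diamondArea p q p 0 = 1 := by simp [diamondArea]
  rw [← h1]
  refine diamondArea_mem_cellVolumes hp hq hpq hp.le le_rfl le_rfl hq.le ?_
  have : Odd p ∨ Odd q := by
    by_contra! hc
    simp only [Int.not_odd_iff_even, even_iff_two_dvd] at hc
    have := hpq.isUnit_of_dvd' hc.1 hc.2
    rw [Int.isUnit_iff] at this
    omega
  rw [show p - 0 - 1 - q * (p - 1) = (p - 1) * (1 - q) by ring, Int.even_mul]
  rcases this with h | h
  · left; rw [Int.odd_iff] at h; rw [Int.even_iff]; omega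
  · right; rw [Int.odd_iff] at h; rw [Int.even_iff]; omega

lemma encard_cellVolumes_one_one : (cellVolumes 1 1 1).encard = 1 := by
  have hpq : IsCoprime (1 : ℤ) 1 := isCoprime_one_left
  rw [encard_eq_one]
  refine ⟨ENNReal.ofReal 1, Subset.antisymm ?_ (singleton_subset_iff.2
    (one_mem_cellVolumes_full one_pos one_pos hpq))⟩
  rintro V ⟨a, b, c, d, h, h', hn, rfl⟩
  obtain ⟨x, y, hx, hxp, hy, hyq, rfl, rfl, rfl, rfl⟩ := exists_center one_pos hpq h h' hn
  rw [volume_cell_full one_pos one_pos hx hxp hy hyq, diamondArea, if_pos (by omega),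
    if_pos (by omega)]
  rfl

lemma encard_cellVolumes_two_three : (cellVolumes 2 3 2).encard = 3 := by
  have hpq : IsCoprime (2 : ℤ) 3 := ⟨-1, 1, by norm_num⟩
  refine le_antisymm (encard_cellVolumes_full_le two_pos three_pos hpq) ?_
  have hsub : (fun n : ℕ => (n : ENNReal)) '' (({1, 2, 4} : Finset ℕ) : Set ℕ) ⊆
      cellVolumes 2 3 2 := by
    have key : ∀ x y : ℤ, 0 ≤ x → x ≤ 2 → 0 ≤ y → y ≤ 3 → (x - y) % 2 = 0 → ∀ n : ℕ,
        diamondArea 2 3 x y = n → (n : ENNReal) ∈ cellVolumes 2 3 2 := by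
      intro x y hx hxp hy hyq h n hn
      rw [← ENNReal.ofReal_natCast, ← hn]
      refine diamondArea_mem_cellVolumes two_pos three_pos hpq hx hxp hy hyq ?_
      rw [Int.even_iff]; omega
    rintro _ ⟨n, hn, rfl⟩
    simp only [Finset.coe_insert, Finset.coe_singleton, mem_insert_iff, mem_singleton_iff] at hn
    rcases hn with rfl | rfl | rfl
    · exact key 0 0 (by norm_num) (by norm_num) (by norm_num) (by norm_num) (by norm_num) 1
        (by simp [diamondArea])
    · exact key 0 2 (by norm_num) (by norm_num) (by norm_num) (by norm_num) (by norm_num) 2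
        (by simp [diamondArea])
    · exact key 1 1 (by norm_num) (by norm_num) (by norm_num) (by norm_num) (by norm_num) 4
        (by simp [diamondArea])
  refine le_trans ?_ (encard_le_encard hsub)
  rw [Nat.cast_injective.encard_image, encard_coe_eq_coe_finsetCard]
  rfl

/-- The open segment from a point of the cell to a point of the closed cut rectangle stays in the
cell. -/
lemma closure_cell (hn : (cell p q a b c d).Nonempty) :
    closure (cell p q a b c d) =
      {z : ℝ × ℝ | a ≤ z.1 ∧ z.1 ≤ b ∧ c ≤ z.2 ∧ z.2 ≤ d} ∩ region p q := by
  apply Subset.antisymm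
  · apply closure_minimal
    · rintro z ⟨⟨h1, h2, h3, h4⟩, h5⟩
      exact ⟨⟨h1.le, h2.le, h3.le, h4.le⟩, h5⟩
    · apply IsClosed.inter
      · exact (isClosed_le continuous_const continuous_fst).inter
          ((isClosed_le continuous_fst continuous_const).inter
          ((isClosed_le continuous_const continuous_snd).inter
          (isClosed_le continuous_snd continuous_const)))
      · have h1 := continuous_fst.sub (continuous_snd (X := ℝ) (Y := ℝ))
        have h2 := continuous_fst.add (continuous_snd (X := ℝ) (Y := ℝ))
        exact (isClosed_le continuous_const h1).inter ((isClosed_le h1 continuous_const).inter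
          ((isClosed_le continuous_const h2).inter (isClosed_le h2 continuous_const)))
  · rintro z ⟨⟨h1, h2, h3, h4⟩, h5⟩
    obtain ⟨w, ⟨k1, k2, k3, k4⟩, k5⟩ := hn
    have hsub : openSegment ℝ w z ⊆ cell p q a b c d := by
      rintro v hv
      refine ⟨?_, (convex_region p q).segment_subset k5 h5 (openSegment_subset_segment _ _ _ hv)⟩
      obtain ⟨s, t, hs, ht, hst, rfl⟩ := hv
      obtain rfl : t = 1 - s := by linarith
      simp only [box, mem_ofPred_eq, Prod.fst_add, Prod.smul_fst, Prod.snd_add, Prod.smul_snd,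
        smul_eq_mul]
      refine ⟨?_, ?_, ?_, ?_⟩ <;> nlinarith
    exact closure_mono hsub (segment_subset_closure_openSegment (right_mem_segment ..))

/-- The part in the table of the diamond centred at `(x / 2p, y / 2q)`. -/
def diamond (p q x y : ℤ) : Set (ℝ × ℝ) :=
  {z | ((-1 ≤ 2 * p * z.1 - x + (2 * q * z.2 - y) ∧ 2 * p * z.1 - x + (2 * q * z.2 - y) ≤ 1) ∧
    (-1 ≤ 2 * p * z.1 - x - (2 * q * z.2 - y) ∧ 2 * p * z.1 - x - (2 * q * z.2 - y) ≤ 1)) ∧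
    (0 ≤ 2 * p * z.1 ∧ 2 * p * z.1 ≤ p) ∧ 0 ≤ 2 * q * z.2 ∧ 2 * q * z.2 ≤ q}

lemma exists_eq_diamond (hp : 0 < p) (hq : 0 < q) (hpq : IsCoprime p q) {P : Set (ℝ × ℝ)}
    (hP : P ∈ pieces (p / q) (p * q / (2 * p))) :
    ∃ x y : ℤ, 0 ≤ x ∧ x ≤ p ∧ 0 ≤ y ∧ y ≤ q ∧ P = diamond p q x y ∧
      ENNReal.ofReal (8 * p * q) * volume P = ENNReal.ofReal (diamondArea p q x y) := by
  obtain ⟨a, b, c, d, h, h', hn, hP⟩ := (mem_pieces_iff hp hq hp).1 hP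
  obtain ⟨x, y, hx, hxp, hy, hyq, rfl, rfl, rfl, rfl⟩ := exists_center hp hpq h h' hn
  have hV := volume_piece hp hq hP
  rw [volume_cell_full hp hq hx hxp hy hyq] at hV
  rw [closure_cell hn] at hP
  have hmem : ∀ z, z ∈ P ↔ toDiag p hp hq z ∈ toDiag p hp hq '' P := fun z => by
    rw [(toDiag p hp hq).injective.mem_set_image]
  rw [hP] at hmem
  have hd : ∀ z : ℝ × ℝ, toDiag p hp hq z =
      (2 * p * z.1 - ((diagCoeff q p).1 * z.2 + (diagCoeff q p).2),
        -(2 * p * z.1) - ((diagCoeff q p).1 * z.2 + (diagCoeff q p).2)) := by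
    intro z
    change (_, _) = _
    ext <;> simp only <;> ring
  by_cases hev : Even p
  -- For even p the diagonal coordinates reflect the table, so the centre is reflected back.
  · refine ⟨x, q - y, hx, hxp, by omega, by omega, ?_, ?_⟩
    · ext z
      rw [hmem, hd]
      simp only [diagCoeff, if_pos hev, diamond, region, mem_inter_iff, mem_ofPred_eq]
      push_cast
      constructor
      · rintro ⟨⟨h1, h2, h3, h4⟩, h5, h6, h7, h8⟩
        refine ⟨⟨⟨?_, ?_⟩, ?_, ?_⟩, ⟨?_, ?_⟩, ?_, ?_⟩ <;> linarith
      · rintro ⟨⟨⟨h1, h2⟩, h3, h4⟩, ⟨h5, h6⟩, h7, h8⟩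
        refine ⟨⟨?_, ?_, ?_, ?_⟩, ?_, ?_, ?_, ?_⟩ <;> linarith
    · rw [hV]
      unfold diamondArea
      have : q - y = 0 ∨ q - y = q ↔ y = 0 ∨ y = q := by omega
      simp only [this]
  · refine ⟨x, y, hx, hxp, hy, hyq, ?_, hV⟩
    ext z
    rw [hmem, hd]
    simp only [diagCoeff, if_neg hev, diamond, region, mem_inter_iff, mem_ofPred_eq]
    push_cast
    constructor
    · rintro ⟨⟨h1, h2, h3, h4⟩, h5, h6, h7, h8⟩
      refine ⟨⟨⟨?_, ?_⟩, ?_, ?_⟩, ⟨?_, ?_⟩, ?_, ?_⟩ <;> linarith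
    · rintro ⟨⟨⟨h1, h2⟩, h3, h4⟩, ⟨h5, h6⟩, h7, h8⟩
      refine ⟨⟨?_, ?_, ?_, ?_⟩, ?_, ?_, ?_, ?_⟩ <;> linarith

end

/-! ### Triangles and rhombi -/

lemma affineIndependent_of_det {a b c : ℝ × ℝ}
    (h : (b.1 - a.1) * (c.2 - a.2) - (b.2 - a.2) * (c.1 - a.1) ≠ 0) :
    AffineIndependent ℝ ![a, b, c] := by
  rw [affineIndependent_iff_of_fintype]
  intro w hw h0
  rw [Finset.weightedVSub_eq_weightedVSubOfPoint_of_sum_eq_zero _ _ _ hw 0,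
    Finset.weightedVSubOfPoint_apply] at h0
  simp only [Fin.sum_univ_three, Matrix.cons_val_zero, Matrix.cons_val_one, Matrix.cons_val,
    vsub_eq_sub, sub_zero] at hw h0
  have h1 := congrArg Prod.fst h0
  have h2 := congrArg Prod.snd h0
  simp only [Prod.fst_add, Prod.smul_fst, Prod.snd_add, Prod.smul_snd, smul_eq_mul, Prod.fst_zero,
    Prod.snd_zero] at h1 h2
  have hw0 : w 0 = -w 1 - w 2 := by linarith
  rw [hw0] at h1 h2
  have k1 : w 1 * ((b.1 - a.1) * (c.2 - a.2) - (b.2 - a.2) * (c.1 - a.1)) = 0 := by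
    linear_combination (c.2 - a.2) * h1 - (c.1 - a.1) * h2
  have k2 : w 2 * ((b.1 - a.1) * (c.2 - a.2) - (b.2 - a.2) * (c.1 - a.1)) = 0 := by
    linear_combination (b.1 - a.1) * h2 - (b.2 - a.2) * h1
  have k1 := (mul_eq_zero.1 k1).resolve_right h
  have k2 := (mul_eq_zero.1 k2).resolve_right h
  intro i
  fin_cases i
  · simpa [k1, k2] using hw0
  · exact k1
  · exact k2

/-- The point whose coordinates are `x` and `y` after rescaling the table to `[0, p] × [0, q]`. -/
def scaled (p q : ℤ) (x y : ℝ) : ℝ × ℝ := (x / (2 * p), y / (2 * q))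

section

variable {p q : ℤ}

lemma scaled_surj (hp : 0 < p) (hq : 0 < q) (z : ℝ × ℝ) : ∃ x y, z = scaled p q x y := by
  have hp' : (0 : ℝ) < p := by exact_mod_cast hp
  have hq' : (0 : ℝ) < q := by exact_mod_cast hq
  exact ⟨2 * p * z.1, 2 * q * z.2, by ext <;> simp only [scaled] <;> field_simp⟩

lemma convex_diamond (p q x y : ℤ) : Convex ℝ (diamond p q x y) := by
  rintro z ⟨⟨⟨h1, h2⟩, h3, h4⟩, ⟨h5, h6⟩, h7, h8⟩ w ⟨⟨⟨k1, k2⟩, k3, k4⟩, ⟨k5, k6⟩, k7, k8⟩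
    s t hs ht hst
  obtain rfl : t = 1 - s := by linarith
  simp only [diamond, mem_ofPred_eq, Prod.fst_add, Prod.smul_fst, Prod.snd_add, Prod.smul_snd,
    smul_eq_mul]
  refine ⟨⟨⟨?_, ?_⟩, ?_, ?_⟩, ⟨?_, ?_⟩, ?_, ?_⟩ <;> nlinarith

lemma scaled_mem_diamond (hp : 0 < p) (hq : 0 < q) (x y : ℤ) (X Y : ℝ) :
    scaled p q X Y ∈ diamond p q x y ↔
      ((-1 ≤ X - x + (Y - y) ∧ X - x + (Y - y) ≤ 1) ∧
        -1 ≤ X - x - (Y - y) ∧ X - x - (Y - y) ≤ 1) ∧ (0 ≤ X ∧ X ≤ p) ∧ 0 ≤ Y ∧ Y ≤ q := by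
  have hp' : (0 : ℝ) < p := by exact_mod_cast hp
  have hq' : (0 : ℝ) < q := by exact_mod_cast hq
  have h1 : 2 * p * (X / (2 * p)) = X := by field_simp
  have h2 : 2 * q * (Y / (2 * q)) = Y := by field_simp
  simp only [diamond, scaled, mem_ofPred_eq, h1, h2]

/-- Barycentric coordinates give one inclusion and convexity the other; rescaling the axes affects
neither. -/
lemma isTriangle_of_barycentric (hp : 0 < p) (hq : 0 < q) {P : Set (ℝ × ℝ)} (hP : Convex ℝ P)
    {x₁ y₁ x₂ y₂ x₃ y₃ : ℝ} (h₁ : scaled p q x₁ y₁ ∈ P) (h₂ : scaled p q x₂ y₂ ∈ P)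
    (h₃ : scaled p q x₃ y₃ ∈ P) (hdet : (x₂ - x₁) * (y₃ - y₁) - (y₂ - y₁) * (x₃ - x₁) ≠ 0)
    (h : ∀ x y, scaled p q x y ∈ P → ∃ r s t : ℝ, 0 ≤ r ∧ 0 ≤ s ∧ 0 ≤ t ∧ r + s + t = 1 ∧
      x = r * x₁ + s * x₂ + t * x₃ ∧ y = r * y₁ + s * y₂ + t * y₃) : IsTriangle P := by
  have hp' : (0 : ℝ) < p := by exact_mod_cast hp
  have hq' : (0 : ℝ) < q := by exact_mod_cast hq
  refine ⟨_, _, _, affineIndependent_of_det (a := scaled p q x₁ y₁) (b := scaled p q x₂ y₂)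
    (c := scaled p q x₃ y₃) ?_, Subset.antisymm ?_ ?_⟩
  · have : (x₂ / (2 * p) - x₁ / (2 * p)) * (y₃ / (2 * q) - y₁ / (2 * q)) -
        (y₂ / (2 * q) - y₁ / (2 * q)) * (x₃ / (2 * p) - x₁ / (2 * p)) =
        ((x₂ - x₁) * (y₃ - y₁) - (y₂ - y₁) * (x₃ - x₁)) / (4 * p * q) := by
      field_simp; ring
    simp only [scaled]
    rw [this]
    exact div_ne_zero hdet (by positivity)
  · intro z hz
    obtain ⟨x, y, rfl⟩ := scaled_surj hp hq z
    obtain ⟨r, s, t, hr, hs, ht, hsum, rfl, rfl⟩ := h x y hz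
    have := (convex_convexHull ℝ {scaled p q x₁ y₁, scaled p q x₂ y₂, scaled p q x₃ y₃}).sum_mem
      (t := Finset.univ) (w := ![r, s, t])
      (z := ![scaled p q x₁ y₁, scaled p q x₂ y₂, scaled p q x₃ y₃])
      (by intro i _; fin_cases i <;> assumption) (by simpa [Fin.sum_univ_three] using hsum)
      (by intro i _; fin_cases i <;> exact subset_convexHull ℝ _ (by simp))
    convert this using 1
    simp only [Fin.sum_univ_three, Matrix.cons_val_zero, Matrix.cons_val_one, Matrix.cons_val]
    ext <;> simp only [scaled, Prod.fst_add, Prod.smul_fst, Prod.snd_add, Prod.smul_snd,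
      smul_eq_mul] <;> ring
  · refine convexHull_min ?_ hP
    rintro z (rfl | rfl | rfl) <;> assumption

lemma isTriangle_of_half_left_right (hp : 0 < p) (hq : 0 < q) {P : Set (ℝ × ℝ)}
    (hP : Convex ℝ P) {x y σ : ℝ} (hσ : σ = 1 ∨ σ = -1)
    (h : ∀ X Y, scaled p q X Y ∈ P ↔ ((-1 ≤ X - x + (Y - y) ∧ X - x + (Y - y) ≤ 1) ∧
        -1 ≤ X - x - (Y - y) ∧ X - x - (Y - y) ≤ 1) ∧ 0 ≤ σ * (X - x)) : IsTriangle P := by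
  rcases hσ with rfl | rfl
  · refine isTriangle_of_barycentric hp hq hP (x₁ := x + 1) (y₁ := y) (x₂ := x) (y₂ := y + 1)
      (x₃ := x) (y₃ := y - 1) ?_ ?_ ?_ (by ring_nf; norm_num) ?_
    · rw [h]; norm_num
    · rw [h]; norm_num
    · rw [h]; norm_num
    · intro X Y hXY
      obtain ⟨⟨⟨h1, h2⟩, h3, h4⟩, h5⟩ := (h X Y).1 hXY
      exact ⟨X - x, (1 - (X - x) + (Y - y)) / 2, (1 - (X - x) - (Y - y)) / 2, by linarith,
        by linarith, by linarith, by ring, by ring, by ring⟩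
  · refine isTriangle_of_barycentric hp hq hP (x₁ := x - 1) (y₁ := y) (x₂ := x) (y₂ := y + 1)
      (x₃ := x) (y₃ := y - 1) ?_ ?_ ?_ (by ring_nf; norm_num) ?_
    · rw [h]; norm_num
    · rw [h]; norm_num
    · rw [h]; norm_num
    · intro X Y hXY
      obtain ⟨⟨⟨h1, h2⟩, h3, h4⟩, h5⟩ := (h X Y).1 hXY
      exact ⟨x - X, (1 - (x - X) + (Y - y)) / 2, (1 - (x - X) - (Y - y)) / 2, by linarith,
        by linarith, by linarith, by ring, by ring, by ring⟩

lemma isTriangle_of_half_bottom_top (hp : 0 < p) (hq : 0 < q) {P : Set (ℝ × ℝ)}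
    (hP : Convex ℝ P) {x y τ : ℝ} (hτ : τ = 1 ∨ τ = -1)
    (h : ∀ X Y, scaled p q X Y ∈ P ↔ ((-1 ≤ X - x + (Y - y) ∧ X - x + (Y - y) ≤ 1) ∧
        -1 ≤ X - x - (Y - y) ∧ X - x - (Y - y) ≤ 1) ∧ 0 ≤ τ * (Y - y)) : IsTriangle P := by
  rcases hτ with rfl | rfl
  · refine isTriangle_of_barycentric hp hq hP (x₁ := x) (y₁ := y + 1) (x₂ := x + 1) (y₂ := y)
      (x₃ := x - 1) (y₃ := y) ?_ ?_ ?_ (by ring_nf; norm_num) ?_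
    · rw [h]; norm_num
    · rw [h]; norm_num
    · rw [h]; norm_num
    · intro X Y hXY
      obtain ⟨⟨⟨h1, h2⟩, h3, h4⟩, h5⟩ := (h X Y).1 hXY
      exact ⟨Y - y, (1 - (Y - y) + (X - x)) / 2, (1 - (Y - y) - (X - x)) / 2, by linarith,
        by linarith, by linarith, by ring, by ring, by ring⟩
  · refine isTriangle_of_barycentric hp hq hP (x₁ := x) (y₁ := y - 1) (x₂ := x + 1) (y₂ := y)
      (x₃ := x - 1) (y₃ := y) ?_ ?_ ?_ (by ring_nf; norm_num) ?_
    · rw [h]; norm_num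
    · rw [h]; norm_num
    · rw [h]; norm_num
    · intro X Y hXY
      obtain ⟨⟨⟨h1, h2⟩, h3, h4⟩, h5⟩ := (h X Y).1 hXY
      exact ⟨y - Y, (1 - (y - Y) + (X - x)) / 2, (1 - (y - Y) - (X - x)) / 2, by linarith,
        by linarith, by linarith, by ring, by ring, by ring⟩

lemma isTriangle_of_quarter (hp : 0 < p) (hq : 0 < q) {P : Set (ℝ × ℝ)}
    (hP : Convex ℝ P) {x y σ τ : ℝ} (hσ : σ = 1 ∨ σ = -1) (hτ : τ = 1 ∨ τ = -1)
    (h : ∀ X Y, scaled p q X Y ∈ P ↔ ((-1 ≤ X - x + (Y - y) ∧ X - x + (Y - y) ≤ 1) ∧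
        -1 ≤ X - x - (Y - y) ∧ X - x - (Y - y) ≤ 1) ∧ 0 ≤ σ * (X - x) ∧ 0 ≤ τ * (Y - y)) :
    IsTriangle P := by
  refine isTriangle_of_barycentric hp hq hP (x₁ := x) (y₁ := y) (x₂ := x + σ) (y₂ := y)
      (x₃ := x) (y₃ := y + τ) ?_ ?_ ?_ ?_ ?_
  · rw [h]; norm_num
  · rw [h]; rcases hσ with rfl | rfl <;> norm_num
  · rw [h]; rcases hτ with rfl | rfl <;> norm_num
  · rcases hσ with rfl | rfl <;> rcases hτ with rfl | rfl <;> norm_num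
  · intro X Y hXY
    obtain ⟨⟨⟨h1, h2⟩, h3, h4⟩, h5, h6⟩ := (h X Y).1 hXY
    refine ⟨1 - σ * (X - x) - τ * (Y - y), σ * (X - x), τ * (Y - y), ?_, h5, h6, by ring, ?_, ?_⟩
    · rcases hσ with rfl | rfl <;> rcases hτ with rfl | rfl <;> linarith
    · rcases hσ with rfl | rfl <;> ring
    · rcases hτ with rfl | rfl <;> ring

lemma isRhombus_of_full (hp : 0 < p) (hq : 0 < q) {P : Set (ℝ × ℝ)}
    (hP : Convex ℝ P) {x y : ℝ}
    (h : ∀ X Y, scaled p q X Y ∈ P ↔ (-1 ≤ X - x + (Y - y) ∧ X - x + (Y - y) ≤ 1) ∧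
        -1 ≤ X - x - (Y - y) ∧ X - x - (Y - y) ≤ 1) : IsRhombus P := by
  have hp' : (0 : ℝ) < p := by exact_mod_cast hp
  have hq' : (0 : ℝ) < q := by exact_mod_cast hq
  refine ⟨scaled p q (x + 1) y, scaled p q x (y + 1), scaled p q (x - 1) y, scaled p q x (y - 1),
    affineIndependent_of_det ?_, ?_, ?_, Subset.antisymm ?_ ?_⟩
  · have : (x / (2 * p) - (x + 1) / (2 * p)) * ((y - 1) / (2 * q) - y / (2 * q)) -
        ((y + 1) / (2 * q) - y / (2 * q)) * (x / (2 * p) - (x + 1) / (2 * p)) =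
        1 / (2 * p * q) := by
      field_simp; ring
    simp only [scaled]
    rw [this]
    positivity
  · ext <;> simp only [scaled, Prod.fst_add, Prod.snd_add] <;> ring
  · simp only [euclDist, scaled]
    congr 1
    ring
  · intro z hz
    obtain ⟨X, Y, rfl⟩ := scaled_surj hp hq z
    obtain ⟨⟨h1, h2⟩, h3, h4⟩ := (h X Y).1 hz
    -- `s` and `t` are coordinates in [0, 1] along the sides; their bilinear products are the
    -- weights of the four vertices.
    obtain ⟨s, hs⟩ : ∃ s, s = (1 + (X - x) + (Y - y)) / 2 := ⟨_, rfl⟩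
    obtain ⟨t, ht⟩ : ∃ t, t = (1 + (X - x) - (Y - y)) / 2 := ⟨_, rfl⟩
    have hs0 : 0 ≤ s := by linarith
    have hs1 : 0 ≤ 1 - s := by linarith
    have ht0 : 0 ≤ t := by linarith
    have ht1 : 0 ≤ 1 - t := by linarith
    have := (convex_convexHull ℝ {scaled p q (x + 1) y, scaled p q x (y + 1),
        scaled p q (x - 1) y, scaled p q x (y - 1)}).sum_mem
      (t := Finset.univ) (w := ![s * t, s * (1 - t), (1 - s) * (1 - t), (1 - s) * t])
      (z := ![scaled p q (x + 1) y, scaled p q x (y + 1), scaled p q (x - 1) y,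
        scaled p q x (y - 1)])
      (by intro i _; fin_cases i <;> simp <;> positivity)
      (by simp [Fin.sum_univ_four]; ring)
      (by intro i _; fin_cases i <;> exact subset_convexHull ℝ _ (by simp))
    convert this using 1
    simp only [Fin.sum_univ_four, Matrix.cons_val_zero, Matrix.cons_val_one, Matrix.cons_val]
    have hX : X = x + (s + t - 1) := by rw [hs, ht]; ring
    have hY : Y = y + (s - t) := by rw [hs, ht]; ring
    rw [hX, hY]
    ext <;> simp only [scaled, Prod.fst_add, Prod.smul_fst, Prod.snd_add, Prod.smul_snd,
      smul_eq_mul] <;> ring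
  · refine convexHull_min ?_ hP
    rintro z (rfl | rfl | rfl | rfl) <;> rw [h] <;> norm_num

lemma diamond_shape (hp : 0 < p) (hq : 0 < q) {x y : ℤ} (hx : 0 ≤ x) (hxp : x ≤ p) (hy : 0 ≤ y)
    (hyq : y ≤ q) :
    (IsRhombus (diamond p q x y) ∧ diamondArea p q x y = 4) ∨
    (IsTriangle (diamond p q x y) ∧ diamondArea p q x y = 2) ∨
    (IsTriangle (diamond p q x y) ∧ diamondArea p q x y = 1) := by
  have hp' : (1 : ℝ) ≤ p := by exact_mod_cast hp
  have hq' : (1 : ℝ) ≤ q := by exact_mod_cast hq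
  have hc := convex_diamond p q x y
  have hm := scaled_mem_diamond hp hq x y
  have hx' : x = 0 ∨ x = p ∨ (1 : ℝ) ≤ x ∧ (x : ℝ) + 1 ≤ p := by
    have : x = 0 ∨ x = p ∨ 1 ≤ x ∧ x + 1 ≤ p := by omega
    exact_mod_cast this
  have hy' : y = 0 ∨ y = q ∨ (1 : ℝ) ≤ y ∧ (y : ℝ) + 1 ≤ q := by
    have : y = 0 ∨ y = q ∨ 1 ≤ y ∧ y + 1 ≤ q := by omega
    exact_mod_cast this
  -- One axis at a time: a centre on a side leaves the half pointing in the inward direction `σ`;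
  -- otherwise the table imposes no cut.
  have hcut : ∀ {x p : ℤ}, 0 < p → x = 0 ∨ x = p ∨ (1 : ℝ) ≤ x ∧ (x : ℝ) + 1 ≤ p →
      (∃ σ : ℝ, (σ = 1 ∨ σ = -1) ∧ (x = 0 ∨ x = p) ∧
        ∀ X : ℝ, -1 ≤ X - x → X - x ≤ 1 → (0 ≤ X ∧ X ≤ p ↔ 0 ≤ σ * (X - x))) ∨
      (¬ (x = 0 ∨ x = p) ∧ ∀ X : ℝ, -1 ≤ X - x → X - x ≤ 1 → (0 ≤ X ∧ X ≤ p)) := by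
    intro x p hp h
    have hp' : (1 : ℝ) ≤ p := by exact_mod_cast hp
    rcases h with rfl | rfl | ⟨h1, h2⟩
    · refine Or.inl ⟨1, Or.inl rfl, Or.inl rfl, fun X h1 h2 => ?_⟩
      simp only [Int.cast_zero, sub_zero, one_mul] at *
      exact ⟨fun h => h.1, fun h => ⟨h, by linarith⟩⟩
    · refine Or.inl ⟨-1, Or.inr rfl, Or.inr rfl, fun X h1 h2 => ?_⟩
      exact ⟨fun h => by linarith [h.2], fun h => ⟨by linarith, by linarith⟩⟩
    · refine Or.inr ⟨?_, fun X h3 h4 => ⟨by linarith, by linarith⟩⟩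
      rintro (rfl | rfl)
      · norm_num at h1
      · linarith
  rcases hcut hp hx' with ⟨σ, hσ, hx0, hX⟩ | ⟨hx0, hX⟩ <;>
    rcases hcut hq hy' with ⟨τ, hτ, hy0, hY⟩ | ⟨hy0, hY⟩
  · refine Or.inr (Or.inr ⟨isTriangle_of_quarter hp hq hc (x := x) (y := y) hσ hτ
      fun X Y => ?_, by simp [diamondArea, hx0, hy0]⟩)
    rw [hm]
    refine and_congr_right ?_
    rintro ⟨⟨h1, h2⟩, h3, h4⟩
    rw [hX X (by linarith) (by linarith), hY Y (by linarith) (by linarith)]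
  · refine Or.inr (Or.inl ⟨isTriangle_of_half_left_right hp hq hc (x := x) (y := y) hσ
      fun X Y => ?_, by simp [diamondArea, hx0, hy0]⟩)
    rw [hm]
    refine and_congr_right ?_
    rintro ⟨⟨h1, h2⟩, h3, h4⟩
    rw [hX X (by linarith) (by linarith), and_iff_left (hY Y (by linarith) (by linarith))]
  · refine Or.inr (Or.inl ⟨isTriangle_of_half_bottom_top hp hq hc (x := x) (y := y) hτ
      fun X Y => ?_, by simp [diamondArea, hx0, hy0]⟩)
    rw [hm]
    refine and_congr_right ?_
    rintro ⟨⟨h1, h2⟩, h3, h4⟩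
    rw [hY Y (by linarith) (by linarith), and_iff_right (hX X (by linarith) (by linarith))]
  · refine Or.inl ⟨isRhombus_of_full hp hq hc (x := x) (y := y)
      fun X Y => ?_, by simp [diamondArea, hx0, hy0]⟩
    rw [hm, and_iff_left_iff_imp]
    rintro ⟨⟨h1, h2⟩, h3, h4⟩
    exact ⟨hX X (by linarith) (by linarith), hY Y (by linarith) (by linarith)⟩

end

/-! ### Periodicity, exchange of the axes and the final bounds -/

lemma distInt_mem (x : ℝ) : 0 ≤ distInt x ∧ distInt x ≤ 1 / 2 :=
  ⟨abs_nonneg _, abs_sub_round x⟩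

lemma distInt_add_int (x : ℝ) (n : ℤ) : distInt (x + n) = distInt x := by
  unfold distInt
  rw [round_add_intCast]
  push_cast
  ring_nf

lemma distInt_neg (x : ℝ) : distInt (-x) = distInt x := by
  obtain ⟨h0, h1⟩ := distInt_mem x
  rw [distInt_eq_iff h0 h1]
  obtain ⟨n, h | h⟩ := (distInt_eq_iff h0 h1).1 rfl
  · exact ⟨-n, Or.inr (by push_cast; linarith)⟩
  · exact ⟨-n, Or.inl (by push_cast; linarith)⟩

/-- The motion is even and q-periodic in time, so subtracting the nearest multiple of q brings every
time into [0, q/2] up to sign. -/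
lemma orbit_eq_of_le {p q : ℤ} (hq : 0 < q) {M : ℝ} (hM : (q : ℝ) / 2 ≤ M) :
    orbit (p / q) M = orbit (p / q) (q / 2) := by
  have hq' : (0 : ℝ) < q := by exact_mod_cast hq
  apply Subset.antisymm
  · rintro _ ⟨x, ⟨h0, -⟩, rfl⟩
    set k := round (x / q) with hk
    have h1 : |x - q * k| ≤ q / 2 := by
      have := abs_sub_round (x / q)
      rw [show x - q * k = q * (x / q - k) by field_simp, abs_mul, abs_of_pos hq']
      nlinarith
    have h2 : distInt (x - q * k) = distInt x := by
      rw [← distInt_add_int x (-(q * k))]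
      push_cast
      ring_nf
    have h3 : distInt (p / q * (x - q * k)) = distInt (p / q * x) := by
      rw [← distInt_add_int (p / q * x) (-(p * k))]
      congr 1
      push_cast
      field_simp
      ring
    refine ⟨|x - q * k|, ⟨abs_nonneg _, h1⟩, ?_⟩
    rw [Prod.mk.injEq, ← h2, ← h3]
    rcases abs_choice (x - q * k) with h | h
    · rw [h]; exact ⟨rfl, rfl⟩
    · rw [h, mul_neg, distInt_neg, distInt_neg]; exact ⟨rfl, rfl⟩
  · exact image_mono (Icc_subset_Icc_right hM)

lemma orbit_swap {α : ℝ} (hα : 0 < α) (M : ℝ) :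
    Prod.swap '' orbit α M = orbit α⁻¹ (α * M) := by
  ext z
  constructor
  · rintro ⟨_, ⟨x, ⟨h0, h1⟩, rfl⟩, rfl⟩
    refine ⟨α * x, ⟨by positivity, by gcongr⟩, ?_⟩
    simp [hα.ne']
  · rintro ⟨x, ⟨h0, h1⟩, rfl⟩
    refine ⟨_, ⟨α⁻¹ * x, ⟨by positivity, ?_⟩, rfl⟩, ?_⟩
    · rw [inv_mul_le_iff₀ hα]; exact h1
    · simp [hα.ne']

/-- Exchanging the axes turns a stop on a vertical side into a stop on a horizontal one, the case
covered by the grid. -/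
lemma numAreas_swap {α : ℝ} (hα : 0 < α) (M : ℝ) :
    numAreas α M = numAreas α⁻¹ (α * M) := by
  have h : (Homeomorph.prodComm ℝ ℝ) '' (table \ orbit α M) =
      table \ orbit α⁻¹ (α * M) := by
    rw [image_sdiff (Homeomorph.prodComm ℝ ℝ).injective]
    congr 1
    · exact image_swap_prod _ _
    · exact orbit_swap hα M
  have h2 : pieces α⁻¹ (α * M) = (fun P => Prod.swap '' P) '' pieces α M := by
    change closedComponents _ = _
    rw [← h, closedComponents_image]
    rfl
  rw [numAreas, numAreas, h2, image_image]
  congr 1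
  refine image_congr fun P _ => ?_
  have := volume_image_affine 0 1 1 0 0 0 P
  simp only [zero_mul, one_mul, zero_add, add_zero, mul_one, zero_sub, abs_neg, abs_one,
    ENNReal.ofReal_one] at this
  exact this.symm

lemma numAreas_le_of_vertical {p q : ℤ} (hp : 0 < p) (hq : 0 < q) {M : ℝ} (hM : 0 < M) {n : ℤ}
    (h : (p : ℝ) / q * M = n / 2) : numAreas (p / q) M ≤ 13 := by
  have hp' : (0 : ℝ) < p := by exact_mod_cast hp
  have hq' : (0 : ℝ) < q := by exact_mod_cast hq
  have hn : 0 < n := by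
    have : (0 : ℝ) < n / 2 := by rw [← h]; positivity
    have : (0 : ℝ) < n := by linarith
    exact_mod_cast this
  have hM' : M = n * q / (2 * p) := by
    field_simp at h ⊢
    linarith
  rw [hM', numAreas_eq_encard hp hq hn]
  exact encard_cellVolumes_le hp hq hn

lemma exists_half_int {x : ℝ} (h : distInt x = 0 ∨ distInt x = 1 / 2) : ∃ n : ℤ, x = n / 2 := by
  rcases h with h | h
  · obtain ⟨n, h | h⟩ := (distInt_eq_iff le_rfl (by norm_num)).1 h
    · exact ⟨2 * n, by push_cast; linarith⟩
    · exact ⟨2 * n, by push_cast; linarith⟩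
  · obtain ⟨n, h | h⟩ := (distInt_eq_iff (by norm_num) le_rfl).1 h
    · exact ⟨2 * n + 1, by push_cast; linarith⟩
    · exact ⟨2 * n - 1, by push_cast; linarith⟩

lemma StopsOnBoundary.half_int {α M : ℝ} (h : StopsOnBoundary α M) :
    (∃ n : ℤ, M = n / 2) ∨ ∃ n : ℤ, α * M = n / 2 := by
  by_contra! hc
  obtain ⟨h1, h2⟩ := hc
  refine h.2 ⟨⟨?_, ?_⟩, ?_, ?_⟩ <;> refine lt_of_le_of_ne ?_ fun h3 => ?_
  · exact (distInt_mem _).1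
  · obtain ⟨n, hn⟩ := exists_half_int (Or.inl h3.symm)
    exact h1 n hn
  · exact (distInt_mem _).2
  · obtain ⟨n, hn⟩ := exists_half_int (Or.inr h3)
    exact h1 n hn
  · exact (distInt_mem _).1
  · obtain ⟨n, hn⟩ := exists_half_int (Or.inl h3.symm)
    exact h2 n hn
  · exact (distInt_mem _).2
  · obtain ⟨n, hn⟩ := exists_half_int (Or.inr h3)
    exact h2 n hn

lemma numAreas_le_thirteen {α : ℚ} (hα : 0 < α) {M : ℝ} (hM : 0 < M)
    (h : StopsOnBoundary α M) : numAreas α M ≤ 13 := by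
  have hp : 0 < α.num := Rat.num_pos.2 hα
  have hq : (0 : ℤ) < α.den := by exact_mod_cast α.den_pos
  have hp' : (0 : ℝ) < α.num := by exact_mod_cast hp
  have hq' : (0 : ℝ) < α.den := by exact_mod_cast hq
  have hα' : (α : ℝ) = (α.num : ℝ) / ((α.den : ℤ) : ℝ) := by
    rw [Int.cast_natCast]; exact Rat.cast_def α
  rcases h.half_int with ⟨n, hn⟩ | ⟨n, hn⟩
  · have hα0 : (0 : ℝ) < α := by exact_mod_cast hα
    rw [numAreas_swap hα0]
    have h1 : (α : ℝ)⁻¹ = ((α.den : ℤ) : ℝ) / (α.num : ℝ) := by rw [hα', inv_div]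
    rw [h1]
    refine numAreas_le_of_vertical hq hp (by positivity) (n := n) ?_
    rw [← h1, inv_mul_cancel_left₀ hα0.ne', hn]
  · rw [hα'] at hn ⊢
    exact numAreas_le_of_vertical hp hq hM hn

lemma numAreas_full {p q : ℤ} (hp : 0 < p) (hq : 0 < q) {M : ℝ} (hM : (q : ℝ) / 2 ≤ M) :
    numAreas (p / q) M = (cellVolumes p q p).encard := by
  have hp' : (0 : ℝ) < p := by exact_mod_cast hp
  rw [← numAreas_eq_encard hp hq hp, show (p * q / (2 * p) : ℝ) = q / 2 by field_simp,
    numAreas, numAreas, pieces, pieces, orbit_eq_of_le hq hM]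

lemma pieces_full {p q : ℤ} (hp : 0 < p) (hq : 0 < q) (hpq : IsCoprime p q) {M : ℝ}
    (hM : (q : ℝ) / 2 ≤ M) {P : Set (ℝ × ℝ)} (hP : P ∈ pieces (p / q) M) :
    (IsRhombus P ∧ volume P = ENNReal.ofReal (1 / (2 * p * q))) ∨
    (IsTriangle P ∧ volume P = ENNReal.ofReal (1 / (4 * p * q))) ∨
    (IsTriangle P ∧ volume P = ENNReal.ofReal (1 / (8 * p * q))) := by
  have hp' : (0 : ℝ) < p := by exact_mod_cast hp
  have hq' : (0 : ℝ) < q := by exact_mod_cast hq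
  rw [pieces, orbit_eq_of_le hq hM, show (q / 2 : ℝ) = p * q / (2 * p) by field_simp] at hP
  obtain ⟨x, y, hx, hxp, hy, hyq, rfl, hV⟩ := exists_eq_diamond hp hq hpq hP
  have hV' : volume (diamond p q x y) = ENNReal.ofReal (diamondArea p q x y / (8 * p * q)) := by
    rw [ENNReal.ofReal_div_of_pos (by positivity), ← hV, mul_comm,
      ENNReal.mul_div_cancel_right (by
        rw [Ne, ENNReal.ofReal_eq_zero, not_le]; positivity) ENNReal.ofReal_ne_top]
  rw [hV']
  rcases diamond_shape hp hq hx hxp hy hyq with ⟨h1, h2⟩ | ⟨h1, h2⟩ | ⟨h1, h2⟩ <;> rw [h2]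
  · refine Or.inl ⟨h1, ?_⟩
    congr 1; field_simp; norm_num
  · refine Or.inr (Or.inl ⟨h1, ?_⟩)
    congr 1; field_simp; norm_num
  · exact Or.inr (Or.inr ⟨h1, rfl⟩)

end

end Billiard

theorem mainTheorem2 :
    -- 13 is an upper bound for rational slopes, and it is attained
    (∀ α : ℚ, 0 < α → ∀ M : ℝ, 0 < M → Billiard.StopsOnBoundary (α : ℝ) M →
      Billiard.numAreas (α : ℝ) M ≤ 13) ∧
    (∃ α : ℚ, 0 < α ∧ ∃ M : ℝ, 0 < M ∧ Billiard.StopsOnBoundary (α : ℝ) M ∧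
      Billiard.numAreas (α : ℝ) M = 13) ∧
    -- for each rational slope the partition is eventually constant, with 1 to 3 areas
    (∀ p q : ℕ, 0 < p → 0 < q → p.Coprime q → ∃ M₀ : ℝ, ∀ M : ℝ, M₀ ≤ M →
      Billiard.pieces ((p : ℝ) / q) M = Billiard.pieces ((p : ℝ) / q) M₀ ∧
      1 ≤ Billiard.numAreas ((p : ℝ) / q) M ∧
      Billiard.numAreas ((p : ℝ) / q) M ≤ 3 ∧
      ∀ P ∈ Billiard.pieces ((p : ℝ) / q) M,
        (Billiard.IsRhombus P ∧
          MeasureTheory.volume P = ENNReal.ofReal (1 / (2 * p * q))) ∨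
        (Billiard.IsTriangle P ∧
          MeasureTheory.volume P = ENNReal.ofReal (1 / (4 * p * q))) ∨
        (Billiard.IsTriangle P ∧
          MeasureTheory.volume P = ENNReal.ofReal (1 / (8 * p * q)))) ∧
    -- both eventual bounds are attained
    (∃ α : ℚ, 0 < α ∧ ∃ M₀ : ℝ, ∀ M : ℝ, M₀ ≤ M → Billiard.numAreas (α : ℝ) M = 1) ∧
    (∃ α : ℚ, 0 < α ∧ ∃ M₀ : ℝ, ∀ M : ℝ, M₀ ≤ M → Billiard.numAreas (α : ℝ) M = 3) := by
  refine ⟨fun α hα M hM h => Billiard.numAreas_le_thirteen hα hM h, ?_, ?_, ?_, ?_⟩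
  -- M = 7·27/(2·22) = 189/44, so αM = 7/2 and the orbit stops on the top side.
  · have h13 := Billiard.numAreas_eq_encard (p := 22) (q := 27) (m := 7) (by norm_num)
      (by norm_num) (by norm_num)
    have hα : ((22 / 27 : ℚ) : ℝ) = ((22 : ℤ) : ℝ) / ((27 : ℤ) : ℝ) := by norm_num
    have hM : (189 / 44 : ℝ) = ((7 : ℤ) : ℝ) * ((27 : ℤ) : ℝ) / (2 * ((22 : ℤ) : ℝ)) := by
      norm_num
    have hbdry : Billiard.StopsOnBoundary ((22 / 27 : ℚ) : ℝ) (189 / 44) := by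
      refine ⟨⟨Billiard.distInt_mem _, Billiard.distInt_mem _⟩, fun h => ?_⟩
      have h1 : Billiard.distInt (((22 / 27 : ℚ) : ℝ) * (189 / 44)) = 1 / 2 := by
        rw [Billiard.distInt_eq_iff (by norm_num) le_rfl]
        exact ⟨3, Or.inl (by norm_num)⟩
      exact h.2.2.ne h1
    refine ⟨22 / 27, by norm_num, 189 / 44, by norm_num, hbdry, le_antisymm
      (Billiard.numAreas_le_thirteen (by norm_num) (by norm_num) hbdry) ?_⟩
    rw [hα, hM, h13]
    exact Billiard.le_encard_cellVolumes_22_27_7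
  · intro p q hp hq hpq
    have hp' : (0 : ℤ) < p := by exact_mod_cast hp
    have hq' : (0 : ℤ) < q := by exact_mod_cast hq
    have hpq' : IsCoprime (p : ℤ) q := Nat.isCoprime_iff_coprime.2 hpq
    have hcast : (p : ℝ) / q = ((p : ℤ) : ℝ) / ((q : ℤ) : ℝ) := by push_cast; rfl
    refine ⟨((q : ℤ) : ℝ) / 2, fun M hM => ?_⟩
    rw [hcast, Billiard.numAreas_full hp' hq' hM]
    refine ⟨?_, ?_, Billiard.encard_cellVolumes_full_le hp' hq' hpq', fun P hP => ?_⟩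
    · rw [Billiard.pieces, Billiard.pieces, Billiard.orbit_eq_of_le hq' hM]
    · rw [Set.one_le_encard_iff_nonempty]
      exact ⟨_, Billiard.one_mem_cellVolumes_full hp' hq' hpq'⟩
    · have := Billiard.pieces_full hp' hq' hpq' hM hP
      rwa [Int.cast_natCast, Int.cast_natCast] at this
  · refine ⟨1, one_pos, ((1 : ℤ) : ℝ) / 2, fun M hM => ?_⟩
    rw [show ((1 : ℚ) : ℝ) = ((1 : ℤ) : ℝ) / ((1 : ℤ) : ℝ) by norm_num,
      Billiard.numAreas_full one_pos one_pos hM]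
    exact Billiard.encard_cellVolumes_one_one
  · refine ⟨2 / 3, by norm_num, ((3 : ℤ) : ℝ) / 2, fun M hM => ?_⟩
    rw [show ((2 / 3 : ℚ) : ℝ) = ((2 : ℤ) : ℝ) / ((3 : ℤ) : ℝ) by norm_num,
      Billiard.numAreas_full two_pos three_pos hM]
    exact Billiard.encard_cellVolumes_two_three
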